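/- Let $n\ge 1$. A function $g:[0,\infty)\to[0,\infty)$ is an $m$-dimensional density generator if it is measurable and $0<\int_0^\infty u^{m/2-1}g(u)\,du<\infty$. For such $g$, $\boldsymbol\mu\in\mathbb R^m$ and a positive definite $\Sigma\in\mathbb R^{m\times m}$, $EC_m(\boldsymbol\mu,\Sigma,g)$ denotes the law on $\mathbb R^m$ with density $c_m|\Sigma|^{-1/2}g\big((\mathbf x-\boldsymbol\mu)'\Sigma^{-1}(\mathbf x-\boldsymbol\mu)\big)$, where $c_m$ is the normalizing constant. Let $\boldsymbol\mu,\boldsymbol\alpha\in\mathbb R^n$, let $\Omega\in\mathbb R^{n\times n}$ be positive definite, and let $g^{(n+1)}$ be an $(n+1)$-dimensional density generator. Put $\boldsymbol\omega=\mathrm{diag}(\Omega)^{1/2}$, $\bar\Omega=\boldsymbol\omega^{-1}\Omega\boldsymbol\omega^{-1}$, $q(\mathbf x)=(\mathbf x-\boldsymbol\mu)'\Omega^{-1}(\mathbf x-\boldsymbol\mu)$, $g^{(n)}(u)=\int_0^\infty r^{-1/2}g^{(n+1)}(r+u)\,dr$ and $g_q(u)=g^{(n+1)}(u+q)/g^{(n)}(q)$.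 Let $\mathbf X\sim SE_n(\boldsymbol\mu,\Omega,\boldsymbol\alpha,g^{(n+1)})$, that is, $\mathbf X$ has the density $$f_{\mathbf X}(\mathbf x)=2f_{g^{(n)}}(\mathbf x;\boldsymbol\mu,\Omega)\,F_{g_{q(\mathbf x)}}\big(\boldsymbol\alpha'\boldsymbol\omega^{-1}(\mathbf x-\boldsymbol\mu)\big),$$ where $f_{g^{(n)}}(\cdot\,;\boldsymbol\mu,\Omega)$ is the density of $EC_n(\boldsymbol\mu,\Omega,g^{(n)})$ and $F_{g_q}$ is the distribution function of $EC_1(0,1,g_q)$. Then there is exactly one pair $(\boldsymbol\delta,\Psi)$ consisting of $\boldsymbol\delta\in(-1,1)^n$ and a positive definite $\Psi\in\mathbb R^{n\times n}$ with unit diagonal such that, with $\Delta=\mathrm{diag}\big((1-\delta_1^2)^{1/2},\dots,(1-\delta_n^2)^{1/2}\big)$ and $\boldsymbol\lambda=\Delta^{-1}\boldsymbol\delta$, $$\bar\Omega=\Delta\Psi\Delta+\boldsymbol\delta\boldsymbol\delta',\qquad \boldsymbol\alpha=(1+\boldsymbol\lambda'\Psi^{-1}\boldsymbol\lambda)^{-1/2}\Delta^{-1}\Psi^{-1}\boldsymbol\lambda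 .$$ For this pair put $\boldsymbol\delta_w=\boldsymbol\omega\boldsymbol\delta$; then $\boldsymbol\omega\Delta\Psi\Delta\boldsymbol\omega=\Omega-\boldsymbol\delta_w\boldsymbol\delta_w'$. Moreover, let $(U_0,\mathbf U')'$ be any random vector with $$\begin{pmatrix}U_0\\ \mathbf U\end{pmatrix}\sim EC_{1+n}\left(\mathbf 0,\begin{pmatrix}1&\mathbf 0'\\ \mathbf 0&\Psi\end{pmatrix},g^{(n+1)}\right).$$ For almost every $u_0$ with respect to the law of $U_0$, the function $g^{(n+1)}(\cdot+u_0^2)$ is an $n$-dimensional density generator and the conditional law of $\mathbf U$ given $U_0=u_0$ is $EC_n(\mathbf 0,\Psi,g^{(n+1)}(\cdot+u_0^2))$. There are real-valued functions $\phi_{u_0}$ such that, for almost every $u_0$ with respect to the law of $U_0$, $E(e^{i\mathbf t'\mathbf U}\mid U_0=u_0)=\phi_{u_0}(\mathbf t'\Psi\mathbf t)$ for all $\mathbf t\in\mathbb R^n$. For every such family $(\phi_{u_0})$ and every $\mathbf t\in\mathbb R^n$, the integrand below is integrable and $$E\big(e^{i\mathbf t'\mathbf X}\big)=2e^{i\mathbf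 t'\boldsymbol\mu}\int_0^\infty e^{i(\mathbf t'\boldsymbol\delta_w)u_0}\,\phi_{u_0}\big(\mathbf t'\boldsymbol\omega\Delta\Psi\Delta\boldsymbol\omega\,\mathbf t\big)\,P(U_0\in du_0),$$ where $\boldsymbol\omega\Delta\Psi\Delta\boldsymbol\omega=\Omega-\boldsymbol\delta_w\boldsymbol\delta_w'$. -/

import Mathlib

open MeasureTheory ProbabilityTheory Matrix

noncomputable section

namespace SkewElliptical

/-- `g` is the density generator of an `m`-dimensional elliptical law: it is measurable,
non-negative on `[0, ∞)`, and `0 < ∫₀^∞ u ^ (m / 2 - 1) g(u) du < ∞`.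
Only the values of `g` on `[0, ∞)` matter. -/
structure IsDensityGenerator (m : ℕ) (g : ℝ → ℝ) : Prop where
  measurable : Measurable g
  nonneg : ∀ u : ℝ, 0 ≤ u → 0 ≤ g u
  integrable : IntegrableOn (fun u : ℝ => u ^ ((m : ℝ) / 2 - 1) * g u) (Set.Ioi 0)
  pos : 0 < ∫ u in Set.Ioi (0 : ℝ), u ^ ((m : ℝ) / 2 - 1) * g u

section Elliptical

variable {ι : Type*} [Fintype ι] [DecidableEq ι]

/-- The quadratic form `q(x) = (x - μ)' Σ⁻¹ (x - μ)`. -/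
def quad (μ : ι → ℝ) (Sig : Matrix ι ι ℝ) (x : ι → ℝ) : ℝ :=
  (x - μ) ⬝ᵥ (Sig⁻¹ *ᵥ (x - μ))

/-- The normalizing constant `c` of the elliptical densities on `ℝ^ι` with generator `g`:
`c⁻¹ = ∫ g(y'y) dy`, which equals `∫ |Σ|^(-1/2) g((x - μ)' Σ⁻¹ (x - μ)) dx` for every `μ` and
every positive definite `Σ`. -/
def normConst (ι : Type*) [Fintype ι] (g : ℝ → ℝ) : ℝ :=
  (∫ y : ι → ℝ, g (y ⬝ᵥ y))⁻¹

/-- The density of `EC(μ, Σ, g)`: `x ↦ c |Σ|^(-1/2) g((x - μ)' Σ⁻¹ (x - μ))`. -/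
def ecDensity (μ : ι → ℝ) (Sig : Matrix ι ι ℝ) (g : ℝ → ℝ) (x : ι → ℝ) : ℝ :=
  normConst ι g * Sig.det ^ (-(1 / 2) : ℝ) * g (quad μ Sig x)

/-- The elliptical law `EC(μ, Σ, g)` on `ℝ^ι`. -/
def ecLaw (μ : ι → ℝ) (Sig : Matrix ι ι ℝ) (g : ℝ → ℝ) : Measure (ι → ℝ) :=
  volume.withDensity fun x => ENNReal.ofReal (ecDensity μ Sig g x)

end Elliptical

/-- The cumulative distribution function of the one-dimensional law `EC₁(0, 1, g)`. -/
def ecCdf (g : ℝ → ℝ) (s : ℝ) : ℝ :=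
  (ecLaw (0 : Fin 1 → ℝ) 1 g).real {v | v 0 ≤ s}

/-- The marginal generator `g⁽ⁿ⁾(u) = ∫₀^∞ r^(-1/2) g⁽ⁿ⁺¹⁾(r + u) dr`. -/
def marginalGen (g : ℝ → ℝ) (u : ℝ) : ℝ :=
  ∫ r in Set.Ioi (0 : ℝ), r ^ (-(1 / 2) : ℝ) * g (r + u)

/-- The generator `g_q(u) = g⁽ⁿ⁺¹⁾(u + q) / g⁽ⁿ⁾(q)`. -/
def condGen (g : ℝ → ℝ) (q u : ℝ) : ℝ :=
  g (u + q) / marginalGen g q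

variable {n : ℕ}

/-- The diagonal scale matrix `ω = diag(Ω)^(1/2)`. -/
def scale (Om : Matrix (Fin n) (Fin n) ℝ) : Matrix (Fin n) (Fin n) ℝ :=
  Matrix.diagonal fun i => √(Om i i)

/-- The correlation matrix `ω⁻¹ Ω ω⁻¹` of `Ω`. -/
def corr (Om : Matrix (Fin n) (Fin n) ℝ) : Matrix (Fin n) (Fin n) ℝ :=
  (scale Om)⁻¹ * Om * (scale Om)⁻¹

/-- The density of `SE_n(μ, Ω, α, g⁽ⁿ⁺¹⁾)`:
`x ↦ 2 f(x; μ, Ω) F_{g_{q(x)}}(α' ω⁻¹ (x - μ))`, where `f(·; μ, Ω)` is the density of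
`EC_n(μ, Ω, g⁽ⁿ⁾)` and `F_{g_q}` is the distribution function of `EC₁(0, 1, g_q)`. -/
def seDensity (μ : Fin n → ℝ) (Om : Matrix (Fin n) (Fin n) ℝ) (α : Fin n → ℝ) (g : ℝ → ℝ)
    (x : Fin n → ℝ) : ℝ :=
  2 * ecDensity μ Om (marginalGen g) x *
    ecCdf (condGen g (quad μ Om x)) (α ⬝ᵥ ((scale Om)⁻¹ *ᵥ (x - μ)))

/-- The skew-elliptical law `SE_n(μ, Ω, α, g⁽ⁿ⁺¹⁾)`. -/
def seLaw (μ : Fin n → ℝ) (Om : Matrix (Fin n) (Fin n) ℝ) (α : Fin n → ℝ) (g : ℝ → ℝ) :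
    Measure (Fin n → ℝ) :=
  volume.withDensity fun x => ENNReal.ofReal (seDensity μ Om α g x)

/-- `Δ = diag((1 - δ₁²)^(1/2), …, (1 - δₙ²)^(1/2))`. -/
def deltaMat (δ : Fin n → ℝ) : Matrix (Fin n) (Fin n) ℝ :=
  Matrix.diagonal fun i => √(1 - δ i ^ 2)

/-- `λ = Δ⁻¹ δ`. -/
def lam (δ : Fin n → ℝ) : Fin n → ℝ :=
  (deltaMat δ)⁻¹ *ᵥ δ

/-- `(Ψ, δ)` are the parameters of the additive construction that correspond to `(Ω, α)`:
`δ ∈ (-1, 1)ⁿ`, `Ψ` is a full rank correlation matrix, `ω⁻¹ Ω ω⁻¹ = Δ Ψ Δ + δ δ'` and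
`α = (1 + λ' Ψ⁻¹ λ)^(-1/2) Δ⁻¹ Ψ⁻¹ λ`. -/
structure IsAdditiveParam (Om : Matrix (Fin n) (Fin n) ℝ) (α δ : Fin n → ℝ)
    (Psi : Matrix (Fin n) (Fin n) ℝ) : Prop where
  delta_mem : ∀ i, δ i ∈ Set.Ioo (-1 : ℝ) 1
  posDef : Psi.PosDef
  diag_eq_one : ∀ i, Psi i i = 1
  corr_eq : corr Om = deltaMat δ * Psi * deltaMat δ + Matrix.vecMulVec δ δ
  alpha_eq : α = (√(1 + lam δ ⬝ᵥ (Psi⁻¹ *ᵥ lam δ)))⁻¹ •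
    ((deltaMat δ)⁻¹ *ᵥ (Psi⁻¹ *ᵥ lam δ))

/-- `φ u₀` is a characteristic generator of the conditional law of `U` given `U₀ = u₀`:
`E(exp(i t'U) | U₀ = u₀) = φ_{u₀}(t' Ψ t)` for all `t`, for almost every `u₀`. -/
def IsCondCharGenerator {S : Type*} [MeasurableSpace S] (P : Measure S) [IsFiniteMeasure P]
    (U₀ : S → ℝ) (U : S → Fin n → ℝ) (Psi : Matrix (Fin n) (Fin n) ℝ) (φ : ℝ → ℝ → ℝ) : Prop :=
  ∀ᵐ u₀ ∂(P.map U₀), ∀ t : Fin n → ℝ,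
    ∫ u, Complex.exp (Complex.I * ((t ⬝ᵥ u : ℝ) : ℂ)) ∂(condDistrib U U₀ P u₀) =
      ((φ u₀ (t ⬝ᵥ (Psi *ᵥ t)) : ℝ) : ℂ)

end SkewElliptical

end

/-! The skew law is an elliptical law of dimension 1 + n seen through a truncation. Put z = x - μ
and β = ω⁻¹α. The factor g⁽ⁿ⁾(q) in the density of EC_n cancels the denominator of g_q, so the skew
density is, for almost every x, 2 c |Ω|^(-1/2) ∫_{v < β'z} g(v² + z'Ω⁻¹z) dv, with c the normalizing
constant of dimension n + 1 (`ofReal_seDensity`).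

Let A = ωΔ, d = ωδ and s² = 1 + λ'Ψ⁻¹λ with s > 0. Then Ω = AΨA' + dd', and Sherman–Morrison shows
that the linear map v = β'z - s u₀, z = u₀ d + A u turns v² + z'Ω⁻¹z into u₀² + u'Ψ⁻¹u and the
half-space v < β'z into u₀ > 0. Hence the law of X is twice the image of the law of (U₀, U),
restricted to u₀ > 0, under (u₀, u) ↦ μ + u₀ d + A u (`IsAdditiveParam.seLaw_eq`).

It remains to integrate exp(i t'X) over u first. Slicing the joint density at u₀ gives EC(0, Ψ, g(·
+ u₀²)) as conditional law (`pairLaw_eq_compProd`). Its characteristic function is real and depends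
on t only through t'Ψt, because the law is invariant under -1 and under the reflections that
preserve the quadratic form (`integral_exp_ecLaw_congr`). Evaluating it at A't gives the formula.

Existence and uniqueness of (δ, Ψ) rest on ω⁻¹Ωω⁻¹α = sδ with s² = 1 + α'ω⁻¹Ωω⁻¹α: this determines δ
from (Ω, α), and then Ψ.

Densities are compared through integrals of nonnegative functions, so that Tonelli applies without
integrability conditions; degenerate slices, of mass 0 or ∞, are dealt with separately. -/

open scoped ENNReal

noncomputable section

namespace SkewElliptical

/-! ### Linear changes of variables and quadratic forms -/

section ChangeOfVariables

variable {ι : Type*} [Fintype ι] [DecidableEq ι]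

lemma lintegral_eq_det_mul_lintegral_mulVec {A : Matrix ι ι ℝ} (hA : A.det ≠ 0)
    {f : (ι → ℝ) → ℝ≥0∞} (hf : Measurable f) :
    ∫⁻ x, f x = ENNReal.ofReal |A.det| * ∫⁻ y, f (A *ᵥ y) := by
  have h := Real.map_matrix_volume_pi_eq_smul_volume_pi hA
  have hm : Measurable (toLin' A) := (LinearMap.continuous_on_pi _).measurable
  have h2 : ∫⁻ y, f (A *ᵥ y) = ∫⁻ x, f x ∂(Measure.map (toLin' A) volume) := by
    rw [lintegral_map hf hm]; rfl
  rw [h2, h, lintegral_smul_measure, smul_eq_mul, ← mul_assoc, ← ENNReal.ofReal_mul (abs_nonneg _),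
    ← abs_mul, mul_inv_cancel₀ hA]
  simp

open scoped MatrixOrder Matrix.Norms.L2Operator in
lemma exists_eq_transpose_mul_self {Sig : Matrix ι ι ℝ} (h : Sig.PosDef) :
    ∃ B : Matrix ι ι ℝ, Sig = Bᵀ * B ∧ B.det ≠ 0 := by
  obtain ⟨B, hB⟩ := CStarAlgebra.nonneg_iff_eq_star_mul_self.mp h.posSemidef.nonneg
  have hB' : Sig = Bᵀ * B := by
    rw [hB, star_eq_conjTranspose, conjTranspose_eq_transpose_of_trivial]
  refine ⟨B, hB', fun h0 => h.det_pos.ne' ?_⟩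
  rw [hB', det_mul, h0, mul_zero]

lemma quad_zero_eq (Sig : Matrix ι ι ℝ) (x : ι → ℝ) : quad 0 Sig x = x ⬝ᵥ (Sig⁻¹ *ᵥ x) := by
  simp [quad]

lemma quad_eq_quad_zero (m : ι → ℝ) (Sig : Matrix ι ι ℝ) (x : ι → ℝ) :
    quad m Sig x = quad 0 Sig (x - m) := by
  simp [quad]

lemma quad_nonneg {Sig : Matrix ι ι ℝ} (h : Sig.PosDef) (m x : ι → ℝ) : 0 ≤ quad m Sig x := by
  simpa [quad] using h.inv.posSemidef.dotProduct_mulVec_nonneg (x - m)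

@[fun_prop]
lemma continuous_quad (m : ι → ℝ) (Sig : Matrix ι ι ℝ) : Continuous (quad m Sig) := by
  unfold quad
  fun_prop

lemma lintegral_quad {Sig : Matrix ι ι ℝ} (hS : Sig.PosDef) {h : ℝ → ℝ≥0∞} (hh : Measurable h) :
    ∫⁻ x, h (quad 0 Sig x) = ENNReal.ofReal √Sig.det * ∫⁻ y : ι → ℝ, h (y ⬝ᵥ y) := by
  obtain ⟨B, hB, hdet⟩ := exists_eq_transpose_mul_self hS
  have hu : IsUnit B.det := isUnit_iff_ne_zero.mpr hdet
  -- With Σ = B'B, the substitution x = B'y turns x'Σ⁻¹x into y'y.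
  rw [lintegral_eq_det_mul_lintegral_mulVec (A := Bᵀ) (by simpa using hdet)
    (f := fun x => h (quad 0 Sig x)) (hh.comp (continuous_quad 0 Sig).measurable)]
  congr 1
  · rw [hB, det_mul, det_transpose, Real.sqrt_mul_self_eq_abs]
  · congr with y
    rw [quad_zero_eq, hB, Matrix.mul_inv_rev, mulVec_mulVec, Matrix.mul_assoc,
      nonsing_inv_mul _ (by simpa using hu), Matrix.mul_one, dotProduct_mulVec, mulVec_transpose,
      vecMul_vecMul, mul_nonsing_inv _ hu, vecMul_one]

end ChangeOfVariables

/-! ### Polar coordinates for nonnegative functions -/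

section Polar

lemma lintegral_comp_sq_Ioi (F : ℝ → ℝ≥0∞) :
    ∫⁻ u in Set.Ioi (0 : ℝ), F u = ∫⁻ r in Set.Ioi (0 : ℝ), ENNReal.ofReal (2 * r) * F (r ^ 2) := by
  have himg : (fun r : ℝ => r ^ 2) '' Set.Ioi 0 = Set.Ioi 0 := by
    ext u
    constructor
    · rintro ⟨r, hr, rfl⟩
      exact pow_pos (Set.mem_Ioi.mp hr) 2
    · intro hu
      exact ⟨√u, Real.sqrt_pos.mpr hu, Real.sq_sqrt (le_of_lt hu)⟩
  have hinj : Set.InjOn (fun r : ℝ => r ^ 2) (Set.Ioi 0) := by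
    intro a ha b hb hab
    exact (sq_eq_sq₀ (le_of_lt ha) (le_of_lt hb)).mp hab
  have := lintegral_image_eq_lintegral_abs_deriv_mul (f := fun r : ℝ => r ^ 2)
    (f' := fun r => 2 * r) measurableSet_Ioi
    (fun x _ => by simpa using (hasDerivAt_pow 2 x).hasDerivWithinAt) hinj F
  rw [himg] at this
  rw [this]
  refine setLIntegral_congr_fun measurableSet_Ioi fun r hr => ?_
  have : (0 : ℝ) < r := hr
  rw [abs_of_pos (by positivity)]

lemma lintegral_sq {h : ℝ → ℝ≥0∞} (hh : Measurable h) :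
    ∫⁻ v : ℝ, h (v ^ 2) = ∫⁻ r in Set.Ioi (0 : ℝ), ENNReal.ofReal (r ^ (-(1 / 2) : ℝ)) * h r := by
  have hsplit : ∫⁻ v : ℝ, h (v ^ 2) = 2 * ∫⁻ v in Set.Ioi (0 : ℝ), h (v ^ 2) := by
    rw [← lintegral_add_compl _ (measurableSet_Ioi (a := (0 : ℝ))), Set.compl_Ioi, two_mul]
    congr 1
    rw [setLIntegral_congr Iio_ae_eq_Iic.symm]
    have hp := (Measure.measurePreserving_neg (volume : Measure ℝ)).setLIntegral_comp_preimage
      (s := Set.Ioi 0) measurableSet_Ioi (f := fun v => h (v ^ 2)) (by fun_prop)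
    simpa using hp
  rw [hsplit, lintegral_comp_sq_Ioi (fun r => ENNReal.ofReal (r ^ (-(1 / 2) : ℝ)) * h r),
    ← lintegral_const_mul _ (by fun_prop)]
  refine setLIntegral_congr_fun measurableSet_Ioi fun r hr => ?_
  have hr : (0 : ℝ) < r := hr
  rw [← mul_assoc, ← ENNReal.ofReal_mul (by positivity), ← Real.rpow_natCast r 2,
    ← Real.rpow_mul hr.le]
  have : 2 * r * r ^ (((2 : ℕ) : ℝ) * -(1 / 2)) = 2 := by
    norm_num
    rw [Real.rpow_neg_one, mul_assoc, mul_inv_cancel₀ hr.ne', mul_one]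
  rw [this]
  simp

/-- Removing the origin, a null set, leaves the sphere times (0, ∞), on which the measure is a
product with radial density r^(dim - 1). -/
lemma lintegral_fun_norm {E : Type*} [NormedAddCommGroup E] [NormedSpace ℝ E]
    [MeasurableSpace E] [Nontrivial E] (m : Measure E) [FiniteDimensional ℝ E] [BorelSpace E]
    [m.IsAddHaarMeasure] {f : ℝ → ℝ≥0∞} (hf : Measurable f) :
    ∫⁻ x, f ‖x‖ ∂m = m.toSphere Set.univ *
      ∫⁻ r in Set.Ioi (0 : ℝ), ENNReal.ofReal (r ^ (Module.finrank ℝ E - 1)) * f r := by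
  calc
    ∫⁻ x, f ‖x‖ ∂m = ∫⁻ x : ({(0)}ᶜ : Set E), f ‖x.1‖ ∂(m.comap (↑)) := by
      rw [lintegral_subtype_comap (measurableSet_singleton _).compl fun x ↦ f ‖x‖,
        restrict_compl_singleton]
    _ = ∫⁻ x, f x.2 ∂m.toSphere.prod (.volumeIoiPow (Module.finrank ℝ E - 1)) := by
      simpa using m.measurePreserving_homeomorphUnitSphereProd.lintegral_comp
        (f := fun x => f x.2) (by fun_prop)
    _ = m.toSphere Set.univ * ∫⁻ x : Set.Ioi (0 : ℝ), f x ∂.volumeIoiPow (Module.finrank ℝ E - 1) := by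
      rw [lintegral_prod _ (by fun_prop)]
      simp [mul_comm]
    _ = _ := by
      rw [Measure.volumeIoiPow, lintegral_withDensity_eq_lintegral_mul _ (by fun_prop) (by fun_prop)]
      congr 1
      exact lintegral_subtype_comap measurableSet_Ioi
        fun a ↦ ENNReal.ofReal (a ^ (Module.finrank ℝ E - 1)) * f a

/-- Later only 0 < C < ∞ matters: C cancels from every criterion that uses it. -/
lemma exists_lintegral_dotProduct_self (ι : Type*) [Fintype ι] [Nonempty ι] :
    ∃ C : ℝ≥0∞, C ≠ 0 ∧ C ≠ ∞ ∧ ∀ h : ℝ → ℝ≥0∞, Measurable h →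
      ∫⁻ y : ι → ℝ, h (y ⬝ᵥ y) = C * ∫⁻ r in Set.Ioi (0 : ℝ),
        ENNReal.ofReal (r ^ ((Fintype.card ι : ℝ) / 2 - 1)) * h r := by
  let m : Measure (EuclideanSpace ℝ ι) := volume
  -- The area of the unit sphere, halved because u = r² has du = 2r dr.
  refine ⟨m.toSphere Set.univ * 2⁻¹, ?_, ?_, fun h hh => ?_⟩
  · simp [(Metric.measure_ball_pos m 0 one_pos).ne']
  · exact ENNReal.mul_ne_top (measure_ne_top _ _) (by simp)
  · have h1 : ∫⁻ y : ι → ℝ, h (y ⬝ᵥ y) = ∫⁻ x : EuclideanSpace ℝ ι, h (‖x‖ ^ 2) := by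
      rw [← (EuclideanSpace.volume_preserving_symm_measurableEquiv_toLp ι).lintegral_comp_emb
        (MeasurableEquiv.measurableEmbedding _)]
      congr with x
      rw [EuclideanSpace.norm_sq_eq]
      simp [dotProduct, pow_two]
    rw [h1, lintegral_fun_norm volume (f := fun r => h (r ^ 2)) (by fun_prop),
      lintegral_comp_sq_Ioi (fun r => ENNReal.ofReal (r ^ ((Fintype.card ι : ℝ) / 2 - 1)) * h r),
      mul_assoc]
    congr 1
    rw [← lintegral_const_mul _ (by fun_prop)]
    refine setLIntegral_congr_fun (measurableSet_Ioi (a := (0 : ℝ))) fun r hr => ?_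
    have hr : (0 : ℝ) < r := hr
    have hcard : 1 ≤ Fintype.card ι := Fintype.card_pos
    simp only [finrank_euclideanSpace]
    rw [← mul_assoc, ← mul_assoc, ← ENNReal.ofReal_ofNat 2, ← ENNReal.ofReal_inv_of_pos two_pos,
      ← ENNReal.ofReal_mul (by positivity), ← ENNReal.ofReal_mul (by positivity)]
    congr 2
    rw [← Real.rpow_natCast r 2, ← Real.rpow_mul hr.le, ← Real.rpow_natCast, Nat.cast_sub hcard]
    have : r ^ (((2 : ℕ) : ℝ) * ((Fintype.card ι : ℝ) / 2 - 1)) * r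
        = r ^ ((Fintype.card ι : ℝ) - (1 : ℕ)) := by
      conv_lhs => rw [← Real.rpow_one r, ← Real.rpow_mul hr.le, ← Real.rpow_add hr]
      congr 1
      push_cast
      ring
    rw [← this]
    ring

end Polar

/-! ### Density generators and normalization -/

section Generators

/-- Trades the one-dimensional moment condition for a condition on an integral over ℝ^ι, to which
Tonelli applies when passing between dimensions n and n + 1. -/
lemma isDensityGenerator_iff (ι : Type*) [Fintype ι] [Nonempty ι] {h : ℝ → ℝ} (hm : Measurable h)
    (h0 : ∀ u, 0 ≤ u → 0 ≤ h u) :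
    IsDensityGenerator (Fintype.card ι) h ↔
      ∫⁻ y : ι → ℝ, ENNReal.ofReal (h (y ⬝ᵥ y)) ≠ 0 ∧
      ∫⁻ y : ι → ℝ, ENNReal.ofReal (h (y ⬝ᵥ y)) ≠ ∞ := by
  obtain ⟨C, hC0, hC, hint⟩ := exists_lintegral_dotProduct_self ι
  rw [hint (fun r => ENNReal.ofReal (h r)) (by fun_prop)]
  set F : ℝ → ℝ := fun u => u ^ ((Fintype.card ι : ℝ) / 2 - 1) * h u with hF
  have hFm : Measurable F := by fun_prop
  have hF0 : 0 ≤ᵐ[volume.restrict (Set.Ioi 0)] F := by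
    filter_upwards [ae_restrict_mem measurableSet_Ioi] with u hu
    exact mul_nonneg (Real.rpow_nonneg (le_of_lt hu) _) (h0 u (le_of_lt hu))
  have hI : ∫⁻ r in Set.Ioi (0 : ℝ), ENNReal.ofReal (r ^ ((Fintype.card ι : ℝ) / 2 - 1)) *
      ENNReal.ofReal (h r) = ∫⁻ r in Set.Ioi (0 : ℝ), ENNReal.ofReal (F r) := by
    refine setLIntegral_congr_fun measurableSet_Ioi fun r hr => ?_
    rw [hF, ENNReal.ofReal_mul (Real.rpow_nonneg (le_of_lt hr) _)]
  rw [hI]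
  have hfin : IntegrableOn F (Set.Ioi 0) ↔ ∫⁻ r in Set.Ioi (0 : ℝ), ENNReal.ofReal (F r) ≠ ∞ := by
    rw [IntegrableOn, Integrable, hasFiniteIntegral_iff_ofReal hF0, lt_top_iff_ne_top]
    exact and_iff_right hFm.aestronglyMeasurable
  have hval := integral_eq_lintegral_of_nonneg_ae hF0 hFm.aestronglyMeasurable
  constructor
  · intro hg
    have hp := hg.pos
    change 0 < ∫ u in Set.Ioi 0, F u at hp
    rw [hval, ENNReal.toReal_pos_iff] at hp
    exact ⟨mul_ne_zero hC0 hp.1.ne', ENNReal.mul_ne_top hC hp.2.ne⟩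
  · rintro ⟨hne, hnt⟩
    have h1 : ∫⁻ r in Set.Ioi (0 : ℝ), ENNReal.ofReal (F r) ≠ 0 := right_ne_zero_of_mul hne
    have h2 : ∫⁻ r in Set.Ioi (0 : ℝ), ENNReal.ofReal (F r) ≠ ∞ :=
      fun htop => hnt (by rw [htop, ENNReal.mul_top hC0])
    refine ⟨hm, h0, hfin.mpr h2, ?_⟩
    change 0 < ∫ u in Set.Ioi 0, F u
    rw [hval]
    exact ENNReal.toReal_pos h1 h2

variable {ι : Type*} [Fintype ι]

lemma dotProduct_self_real_nonneg (y : ι → ℝ) : 0 ≤ y ⬝ᵥ y :=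
  Finset.sum_nonneg fun i _ => mul_self_nonneg (y i)

lemma normConst_eq {h : ℝ → ℝ} (hm : Measurable h) (h0 : ∀ u, 0 ≤ u → 0 ≤ h u) :
    normConst ι h = (∫⁻ y : ι → ℝ, ENNReal.ofReal (h (y ⬝ᵥ y))).toReal⁻¹ := by
  rw [normConst, integral_eq_lintegral_of_nonneg_ae
    (Filter.Eventually.of_forall fun y => h0 _ (dotProduct_self_real_nonneg y))
    (Measurable.aestronglyMeasurable (by fun_prop))]

lemma normConst_nonneg {h : ℝ → ℝ} (h0 : ∀ u, 0 ≤ u → 0 ≤ h u) : 0 ≤ normConst ι h :=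
  inv_nonneg.mpr (integral_nonneg fun y => h0 _ (dotProduct_self_real_nonneg y))

lemma ofReal_normConst {h : ℝ → ℝ} (hm : Measurable h) (h0 : ∀ u, 0 ≤ u → 0 ≤ h u)
    (hpos : ∫⁻ y : ι → ℝ, ENNReal.ofReal (h (y ⬝ᵥ y)) ≠ 0)
    (hfin : ∫⁻ y : ι → ℝ, ENNReal.ofReal (h (y ⬝ᵥ y)) ≠ ∞) :
    ENNReal.ofReal (normConst ι h) = (∫⁻ y : ι → ℝ, ENNReal.ofReal (h (y ⬝ᵥ y)))⁻¹ := by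
  rw [normConst_eq hm h0, ENNReal.ofReal_inv_of_pos (ENNReal.toReal_pos hpos hfin),
    ENNReal.ofReal_toReal hfin]

variable [DecidableEq ι]

@[fun_prop]
lemma measurable_ecDensity (m : ι → ℝ) (Sig : Matrix ι ι ℝ) {h : ℝ → ℝ} (hm : Measurable h) :
    Measurable (ecDensity m Sig h) :=
  measurable_const.mul (hm.comp (continuous_quad m Sig).measurable)

lemma lintegral_ecLaw {Sig : Matrix ι ι ℝ} (hS : Sig.PosDef) {h : ℝ → ℝ} (hm : Measurable h)
    (h0 : ∀ u, 0 ≤ u → 0 ≤ h u) {f : (ι → ℝ) → ℝ≥0∞} (hf : Measurable f) :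
    ∫⁻ u, f u ∂(ecLaw 0 Sig h) =
      ENNReal.ofReal (normConst ι h) * ENNReal.ofReal (Sig.det ^ (-(1 / 2) : ℝ)) *
        ∫⁻ u, ENNReal.ofReal (h (quad 0 Sig u)) * f u := by
  have hc : 0 ≤ normConst ι h := normConst_nonneg h0
  have hd := Real.rpow_nonneg hS.det_pos.le (-(1 / 2) : ℝ)
  have hq : Measurable fun u => h (quad 0 Sig u) := hm.comp (continuous_quad 0 Sig).measurable
  rw [ecLaw, lintegral_withDensity_eq_lintegral_mul _
      (measurable_ecDensity 0 Sig hm).ennreal_ofReal hf,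
    ← lintegral_const_mul _ (by fun_prop)]
  congr with u
  simp only [Pi.mul_apply, ecDensity]
  rw [ENNReal.ofReal_mul (mul_nonneg hc hd), ENNReal.ofReal_mul hc]
  ring

lemma ofReal_det_rpow_mul_sqrt {Sig : Matrix ι ι ℝ} (hS : Sig.PosDef) :
    ENNReal.ofReal (Sig.det ^ (-(1 / 2) : ℝ)) * ENNReal.ofReal √Sig.det = 1 := by
  rw [← ENNReal.ofReal_mul (Real.rpow_nonneg hS.det_pos.le _), Real.sqrt_eq_rpow,
    ← Real.rpow_add hS.det_pos]
  simp

lemma ecLaw_univ {Sig : Matrix ι ι ℝ} (hS : Sig.PosDef) {h : ℝ → ℝ} (hm : Measurable h)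
    (h0 : ∀ u, 0 ≤ u → 0 ≤ h u) :
    ecLaw 0 Sig h Set.univ = ENNReal.ofReal (normConst ι h) *
      ∫⁻ y : ι → ℝ, ENNReal.ofReal (h (y ⬝ᵥ y)) := by
  rw [← lintegral_one, lintegral_ecLaw hS hm h0 measurable_const]
  simp only [mul_one]
  rw [lintegral_quad hS (h := fun r => ENNReal.ofReal (h r)) (by fun_prop), mul_assoc,
    ← mul_assoc (ENNReal.ofReal (Sig.det ^ _)), ofReal_det_rpow_mul_sqrt hS, one_mul]

/-- The total mass is 1 for a proper generator. It is 0 if the integral of h(y'y) is 0 or ∞, since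
the normalizing constant then takes the default value 0. The conditional laws therefore form a
finite kernel with no exceptional u₀ to exclude. -/
lemma ecLaw_univ_le_one {Sig : Matrix ι ι ℝ} (hS : Sig.PosDef) {h : ℝ → ℝ} (hm : Measurable h)
    (h0 : ∀ u, 0 ≤ u → 0 ≤ h u) : ecLaw 0 Sig h Set.univ ≤ 1 := by
  rw [ecLaw_univ hS hm h0]
  by_cases hz : ∫⁻ y : ι → ℝ, ENNReal.ofReal (h (y ⬝ᵥ y)) = 0
  · simp [hz]
  by_cases ht : ∫⁻ y : ι → ℝ, ENNReal.ofReal (h (y ⬝ᵥ y)) = ∞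
  · simp [normConst_eq hm h0, ht]
  · rw [ofReal_normConst hm h0 hz ht, ENNReal.inv_mul_cancel hz ht]

end Generators

/-! ### The joint law of (U₀, U) on a product space -/

section Pair

variable {ι : Type*} [Fintype ι]

/-- The identification of `ℝ^(1 + ι)` with `ℝ × ℝ^ι`. -/
def pairEquiv (ι : Type*) : (Unit ⊕ ι → ℝ) ≃ᵐ ℝ × (ι → ℝ) :=
  (MeasurableEquiv.sumPiEquivProdPi fun _ : Unit ⊕ ι => ℝ).trans
    ((MeasurableEquiv.funUnique Unit ℝ).prodCongr (MeasurableEquiv.refl _))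

omit [Fintype ι] in
lemma pairEquiv_apply (y : Unit ⊕ ι → ℝ) :
    pairEquiv ι y = (y (Sum.inl ()), fun i => y (Sum.inr i)) := rfl

lemma measurePreserving_pairEquiv : MeasurePreserving (pairEquiv ι) volume volume :=
  (volume_measurePreserving_sumPiEquivProdPi fun _ : Unit ⊕ ι => ℝ).trans
    ((volume_preserving_funUnique Unit ℝ).prod (MeasurePreserving.id _))

lemma lintegral_pairEquiv {f : ℝ × (ι → ℝ) → ℝ≥0∞} (hf : Measurable f) :
    ∫⁻ y, f (pairEquiv ι y) = ∫⁻ v, ∫⁻ z, f (v, z) := by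
  rw [measurePreserving_pairEquiv.lintegral_comp hf, Measure.volume_eq_prod,
    lintegral_prod _ hf.aemeasurable]

lemma lintegral_dotProduct_self_sum {h : ℝ → ℝ≥0∞} (hh : Measurable h) :
    ∫⁻ y : Unit ⊕ ι → ℝ, h (y ⬝ᵥ y) = ∫⁻ v : ℝ, ∫⁻ z : ι → ℝ, h (v ^ 2 + z ⬝ᵥ z) := by
  rw [← lintegral_pairEquiv (f := fun p => h (p.1 ^ 2 + p.2 ⬝ᵥ p.2)) (by fun_prop)]
  congr with y
  simp [pairEquiv_apply, dotProduct, pow_two]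

variable [DecidableEq ι]

/-- The law of `(U₀, U)`, as a measure on `ℝ × ℝ^ι`. -/
def pairLaw (Psi : Matrix ι ι ℝ) (g : ℝ → ℝ) : Measure (ℝ × (ι → ℝ)) :=
  volume.withDensity fun p =>
    ENNReal.ofReal (normConst (Unit ⊕ ι) g * Psi.det ^ (-(1 / 2) : ℝ)) *
      ENNReal.ofReal (g (p.1 ^ 2 + quad 0 Psi p.2))

lemma lintegral_pairLaw (Psi : Matrix ι ι ℝ) {g : ℝ → ℝ} (hm : Measurable g)
    {f : ℝ × (ι → ℝ) → ℝ≥0∞} (hf : Measurable f) :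
    ∫⁻ p, f p ∂(pairLaw Psi g) =
      ENNReal.ofReal (normConst (Unit ⊕ ι) g * Psi.det ^ (-(1 / 2) : ℝ)) *
        ∫⁻ v, ∫⁻ z, ENNReal.ofReal (g (v ^ 2 + quad 0 Psi z)) * f (v, z) := by
  have hq : Measurable fun p : ℝ × (ι → ℝ) => g (p.1 ^ 2 + quad 0 Psi p.2) := by
    have : Continuous fun p : ℝ × (ι → ℝ) => p.1 ^ 2 + quad 0 Psi p.2 := by fun_prop
    exact hm.comp this.measurable
  rw [pairLaw, lintegral_withDensity_eq_lintegral_mul _ (by fun_prop) hf, Measure.volume_eq_prod,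
    ← lintegral_prod (fun p => ENNReal.ofReal (g (p.1 ^ 2 + quad 0 Psi p.2)) * f p) (by fun_prop),
    ← lintegral_const_mul _ (by fun_prop)]
  simp [mul_assoc]

lemma quad_fromBlocks {Psi : Matrix ι ι ℝ} (hP : Psi.PosDef) (y : Unit ⊕ ι → ℝ) :
    quad 0 (fromBlocks 1 0 0 Psi) y = y (Sum.inl ()) ^ 2 + quad 0 Psi (fun i => y (Sum.inr i)) := by
  have hinv : (fromBlocks (1 : Matrix Unit Unit ℝ) 0 0 Psi)⁻¹ = fromBlocks 1 0 0 Psi⁻¹ := by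
    refine inv_eq_right_inv ?_
    rw [fromBlocks_multiply]
    simp [mul_nonsing_inv _ (isUnit_iff_ne_zero.mpr hP.det_pos.ne')]
  obtain ⟨a, b, rfl⟩ : ∃ a b, y = Sum.elim a b := ⟨_, _, (Sum.elim_comp_inl_inr y).symm⟩
  rw [quad_zero_eq, quad_zero_eq, hinv, fromBlocks_mulVec]
  simp [dotProduct, pow_two]

lemma map_pairEquiv_ecLaw {Psi : Matrix ι ι ℝ} (hP : Psi.PosDef) {g : ℝ → ℝ} (hm : Measurable g)
    (g0 : ∀ u, 0 ≤ u → 0 ≤ g u) :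
    (ecLaw (0 : Unit ⊕ ι → ℝ) (fromBlocks 1 0 0 Psi) g).map (pairEquiv ι) = pairLaw Psi g := by
  refine Measure.ext_of_lintegral _ fun f hf => ?_
  have hdet : (fromBlocks (1 : Matrix Unit Unit ℝ) 0 0 Psi).det = Psi.det := by simp
  have hq : Measurable fun p : ℝ × (ι → ℝ) => g (p.1 ^ 2 + quad 0 Psi p.2) := by
    have : Continuous fun p : ℝ × (ι → ℝ) => p.1 ^ 2 + quad 0 Psi p.2 := by fun_prop
    exact hm.comp this.measurable
  have hc : 0 ≤ normConst (Unit ⊕ ι) g * Psi.det ^ (-(1 / 2) : ℝ) :=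
    mul_nonneg (normConst_nonneg g0) (Real.rpow_nonneg hP.det_pos.le _)
  rw [lintegral_map hf (pairEquiv ι).measurable, lintegral_pairLaw Psi hm hf, ecLaw,
    lintegral_withDensity_eq_lintegral_mul _ (measurable_ecDensity _ _ hm).ennreal_ofReal
      (g := fun y => f (pairEquiv ι y)) (hf.comp (pairEquiv ι).measurable),
    ← lintegral_pairEquiv (f := fun p => ENNReal.ofReal (g (p.1 ^ 2 + quad 0 Psi p.2)) * f p)
      (by fun_prop),
    ← lintegral_const_mul _ (f := fun y => ENNReal.ofReal
      (g ((pairEquiv ι y).1 ^ 2 + quad 0 Psi (pairEquiv ι y).2)) * f (pairEquiv ι y))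
      (((hq.ennreal_ofReal).mul hf).comp (pairEquiv ι).measurable)]
  congr with y
  simp only [Pi.mul_apply, ecDensity]
  rw [hdet, ENNReal.ofReal_mul hc, quad_fromBlocks hP, mul_assoc]
  rfl

end Pair

/-! ### The conditional law of U given U₀ -/

section Conditional

variable {ι : Type*} [Fintype ι] [DecidableEq ι]

lemma measurable_ecDensity_shift (Psi : Matrix ι ι ℝ) {g : ℝ → ℝ} (hm : Measurable g) :
    Measurable (Function.uncurry fun (u₀ : ℝ) (u : ι → ℝ) =>
      ENNReal.ofReal (ecDensity 0 Psi (fun r => g (r + u₀ ^ 2)) u)) := by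
  have hn : Measurable fun u₀ : ℝ => normConst ι fun r => g (r + u₀ ^ 2) := by
    unfold normConst
    refine Measurable.inv (StronglyMeasurable.measurable ?_)
    refine StronglyMeasurable.integral_prod_right
      (f := fun (u₀ : ℝ) (y : ι → ℝ) => g (y ⬝ᵥ y + u₀ ^ 2)) (Measurable.stronglyMeasurable ?_)
    simp only [Function.uncurry_def]
    fun_prop
  have hq : Measurable fun p : ℝ × (ι → ℝ) => g (quad 0 Psi p.2 + p.1 ^ 2) := by
    have : Continuous fun p : ℝ × (ι → ℝ) => quad 0 Psi p.2 + p.1 ^ 2 := by fun_prop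
    exact hm.comp this.measurable
  simp only [Function.uncurry_def, ecDensity]
  exact (((hn.comp measurable_fst).mul_const _).mul hq).ennreal_ofReal

/-- The kernel `u₀ ↦ EC(0, Ψ, g(· + u₀²))`. -/
def condKernelEC (Psi : Matrix ι ι ℝ) (g : ℝ → ℝ) : Kernel ℝ (ι → ℝ) :=
  Kernel.withDensity (Kernel.const ℝ volume) fun u₀ u =>
    ENNReal.ofReal (ecDensity 0 Psi (fun r => g (r + u₀ ^ 2)) u)

lemma condKernelEC_apply (Psi : Matrix ι ι ℝ) {g : ℝ → ℝ} (hm : Measurable g) (u₀ : ℝ) :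
    condKernelEC Psi g u₀ = ecLaw 0 Psi (fun r => g (r + u₀ ^ 2)) := by
  rw [condKernelEC, Kernel.withDensity_apply _ (measurable_ecDensity_shift Psi hm),
    Kernel.const_apply, ecLaw]

lemma shift_nonneg {g : ℝ → ℝ} (g0 : ∀ u, 0 ≤ u → 0 ≤ g u) (u₀ : ℝ) (u : ℝ) (hu : 0 ≤ u) :
    0 ≤ g (u + u₀ ^ 2) := g0 _ (by positivity)

lemma isFiniteKernel_condKernelEC {Psi : Matrix ι ι ℝ} (hP : Psi.PosDef) {g : ℝ → ℝ}
    (hm : Measurable g) (g0 : ∀ u, 0 ≤ u → 0 ≤ g u) : IsFiniteKernel (condKernelEC Psi g) := by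
  refine ⟨1, ENNReal.one_lt_top, fun u₀ => ?_⟩
  rw [condKernelEC_apply Psi hm]
  exact ecLaw_univ_le_one hP (by fun_prop) (shift_nonneg g0 u₀)

lemma card_unit_sum (n : ℕ) : Fintype.card (Unit ⊕ Fin n) = n + 1 := by
  simp [add_comm]

lemma lintegral_sum_ne {n : ℕ} {g : ℝ → ℝ} (hg : IsDensityGenerator (n + 1) g) :
    ∫⁻ y : Unit ⊕ Fin n → ℝ, ENNReal.ofReal (g (y ⬝ᵥ y)) ≠ 0 ∧
    ∫⁻ y : Unit ⊕ Fin n → ℝ, ENNReal.ofReal (g (y ⬝ᵥ y)) ≠ ∞ := by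
  refine (isDensityGenerator_iff (Unit ⊕ Fin n) hg.measurable hg.nonneg).mp ?_
  rwa [card_unit_sum]

/-- By Tonelli these slice integrals integrate to the finite (n + 1)-dimensional integral of g(y'y).
-/
lemma ae_lintegral_shift_ne_top {n : ℕ} {g : ℝ → ℝ} (hg : IsDensityGenerator (n + 1) g) :
    ∀ᵐ u₀ : ℝ, ∫⁻ z : Fin n → ℝ, ENNReal.ofReal (g (z ⬝ᵥ z + u₀ ^ 2)) ≠ ∞ := by
  have h := (lintegral_sum_ne hg).2
  have hm := hg.measurable
  rw [lintegral_dotProduct_self_sum (h := fun r => ENNReal.ofReal (g r)) (by fun_prop)] at h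
  filter_upwards [ae_lt_top (Measurable.lintegral_prod_right (by fun_prop)) h] with u hu
  simpa [add_comm] using hu.ne

/-- For fixed u₀ the joint density is a multiple of the density of EC(0, Ψ, g(· + u₀²)), the
multiple being the marginal density of U₀ at u₀. -/
lemma pairLaw_eq_compProd {n : ℕ} {g : ℝ → ℝ} (hg : IsDensityGenerator (n + 1) g)
    {Psi : Matrix (Fin n) (Fin n) ℝ} (hP : Psi.PosDef) [SFinite (pairLaw Psi g)] :
    pairLaw Psi g = (pairLaw Psi g).map Prod.fst ⊗ₘ condKernelEC Psi g := by
  have hm := hg.measurable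
  have g0 := hg.nonneg
  have := isFiniteKernel_condKernelEC hP hm g0
  refine Measure.ext_of_lintegral _ fun f hf => ?_
  have hq : Measurable fun p : ℝ × (Fin n → ℝ) => g (p.1 ^ 2 + quad 0 Psi p.2) := by
    have : Continuous fun p : ℝ × (Fin n → ℝ) => p.1 ^ 2 + quad 0 Psi p.2 := by fun_prop
    exact hm.comp this.measurable
  have hk : Measurable fun u₀ => ∫⁻ u, f (u₀, u) ∂condKernelEC Psi g u₀ :=
    hf.lintegral_kernel_prod_right'
  rw [Measure.lintegral_compProd hf, lintegral_map hk measurable_fst,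
    lintegral_pairLaw Psi hm hf,
    lintegral_pairLaw Psi hm (f := fun p => ∫⁻ u, f (p.1, u) ∂condKernelEC Psi g p.1)
      (hk.comp measurable_fst)]
  congr 1
  refine lintegral_congr_ae ?_
  filter_upwards [ae_lintegral_shift_ne_top hg] with u₀ hfin
  have hgm : Measurable fun z : Fin n → ℝ => g (quad 0 Psi z + u₀ ^ 2) := by
    have : Continuous fun z : Fin n → ℝ => quad 0 Psi z + u₀ ^ 2 := by fun_prop
    exact hm.comp this.measurable
  simp only [add_comm (u₀ ^ 2)]
  rw [lintegral_mul_const _ hgm.ennreal_ofReal, condKernelEC_apply Psi hm,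
    lintegral_ecLaw hP (by fun_prop) (shift_nonneg g0 u₀) (by fun_prop)]
  have hquad := lintegral_quad hP (h := fun r => ENNReal.ofReal (g (r + u₀ ^ 2))) (by fun_prop)
  -- On a slice of mass zero the kernel carries no information, but g vanishes almost everywhere
  -- there, so both sides are 0. Otherwise the slice integral cancels the normalizing constant.
  by_cases hz : ∫⁻ z : Fin n → ℝ, ENNReal.ofReal (g (z ⬝ᵥ z + u₀ ^ 2)) = 0
  · rw [hz, mul_zero] at hquad
    rw [hquad, zero_mul]
    rw [lintegral_eq_zero_iff (by fun_prop)] at hquad ⊢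
    filter_upwards [hquad] with z hz
    simp only [Pi.zero_apply] at hz ⊢
    rw [hz, zero_mul]
  · have hn := ofReal_normConst (ι := Fin n) (h := fun r => g (r + u₀ ^ 2)) (by fun_prop)
      (shift_nonneg g0 u₀) hz hfin
    rw [hquad, hn]
    set I := ∫⁻ z : Fin n → ℝ, ENNReal.ofReal (g (z ⬝ᵥ z + u₀ ^ 2))
    set L := ∫⁻ z : Fin n → ℝ, ENNReal.ofReal (g (quad 0 Psi z + u₀ ^ 2)) * f (u₀, z)
    calc L = (ENNReal.ofReal (Psi.det ^ (-(1 / 2) : ℝ)) * ENNReal.ofReal √Psi.det) *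
          (I * I⁻¹) * L := by
          rw [ofReal_det_rpow_mul_sqrt hP, ENNReal.mul_inv_cancel hz hfin, one_mul, one_mul]
      _ = _ := by ring

/-- Up to a constant, the slice integral is the Lebesgue density of U₀. Hence U₀ avoids its zero set
almost surely, and the set where it is infinite is Lebesgue null. -/
lemma ae_map_fst_pairLaw_isDensityGenerator {n : ℕ} (hn : 0 < n) {g : ℝ → ℝ}
    (hg : IsDensityGenerator (n + 1) g) {Psi : Matrix (Fin n) (Fin n) ℝ} (hP : Psi.PosDef) :
    ∀ᵐ u₀ ∂((pairLaw Psi g).map Prod.fst), IsDensityGenerator n fun u => g (u + u₀ ^ 2) := by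
  have hm := hg.measurable
  have : Nonempty (Fin n) := ⟨⟨0, hn⟩⟩
  set k : ℝ → ℝ≥0∞ := fun u₀ => ∫⁻ z : Fin n → ℝ, ENNReal.ofReal (g (z ⬝ᵥ z + u₀ ^ 2)) with hk
  have hkm : Measurable k := Measurable.lintegral_prod_right (by fun_prop)
  have hset : MeasurableSet {u₀ | ¬(k u₀ ≠ 0 ∧ k u₀ ≠ ∞)} :=
    (((hkm (measurableSet_singleton 0)).compl).inter
      ((hkm (measurableSet_singleton ∞)).compl)).compl
  have hae : ∀ᵐ u₀ ∂((pairLaw Psi g).map Prod.fst), k u₀ ≠ 0 ∧ k u₀ ≠ ∞ := by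
    rw [ae_iff, ← lintegral_indicator_one hset, lintegral_map (by measurability) measurable_fst,
      lintegral_pairLaw Psi hm (f := fun p => Set.indicator {u₀ | ¬(k u₀ ≠ 0 ∧ k u₀ ≠ ∞)} 1 p.1)
        ((measurable_one.indicator hset).comp measurable_fst)]
    refine mul_eq_zero_of_right _ ?_
    have hquad (u₀ : ℝ) := lintegral_quad hP (h := fun r => ENNReal.ofReal (g (r + u₀ ^ 2)))
      (by fun_prop)
    refine (lintegral_congr_ae (g := fun _ => 0) ?_).trans lintegral_zero
    filter_upwards [ae_lintegral_shift_ne_top hg] with u₀ hfin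
    have hgm : Measurable fun z : Fin n → ℝ => g (quad 0 Psi z + u₀ ^ 2) := by
      have : Continuous fun z : Fin n → ℝ => quad 0 Psi z + u₀ ^ 2 := by fun_prop
      exact hm.comp this.measurable
    simp only [add_comm (u₀ ^ 2)]
    rw [lintegral_mul_const _ hgm.ennreal_ofReal, hquad u₀]
    by_cases hz : k u₀ = 0
    · rw [show ∫⁻ z : Fin n → ℝ, ENNReal.ofReal (g (z ⬝ᵥ z + u₀ ^ 2)) = 0 from hz]
      simp
    · rw [Set.indicator_of_notMem, mul_zero]
      exact fun hmem => hmem ⟨hz, hfin⟩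
  filter_upwards [hae] with u₀ hu
  simpa using (isDensityGenerator_iff (Fin n) (h := fun u => g (u + u₀ ^ 2)) (by fun_prop)
    (shift_nonneg hg.nonneg u₀)).mpr hu

end Conditional

/-! ### The marginal generator and the one-dimensional distribution function -/

section Marginal

/-- The substitution r = v² exhibits g⁽ⁿ⁾ as the integral over one extra coordinate v; it takes the
value 0 where that integral diverges. -/
lemma marginalGen_eq {g : ℝ → ℝ} (hm : Measurable g) (g0 : ∀ u, 0 ≤ u → 0 ≤ g u) {q : ℝ}
    (hq : 0 ≤ q) : marginalGen g q = (∫⁻ v : ℝ, ENNReal.ofReal (g (v ^ 2 + q))).toReal := by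
  rw [lintegral_sq (h := fun r => ENNReal.ofReal (g (r + q))) (by fun_prop), marginalGen,
    integral_eq_lintegral_of_nonneg_ae]
  · congr 1
    refine setLIntegral_congr_fun measurableSet_Ioi fun r hr => ?_
    rw [ENNReal.ofReal_mul (Real.rpow_nonneg (le_of_lt hr) _)]
  · filter_upwards [ae_restrict_mem measurableSet_Ioi] with r hr
    exact mul_nonneg (Real.rpow_nonneg (le_of_lt hr) _) (g0 _ (add_nonneg (le_of_lt hr) hq))
  · exact Measurable.aestronglyMeasurable (by fun_prop)

lemma marginalGen_nonneg {g : ℝ → ℝ} (g0 : ∀ u, 0 ≤ u → 0 ≤ g u) (q : ℝ) (hq : 0 ≤ q) :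
    0 ≤ marginalGen g q :=
  setIntegral_nonneg measurableSet_Ioi fun _ hr =>
    mul_nonneg (Real.rpow_nonneg (le_of_lt hr) _) (g0 _ (add_nonneg (le_of_lt hr) hq))

@[fun_prop]
lemma measurable_marginalGen {g : ℝ → ℝ} (hm : Measurable g) : Measurable (marginalGen g) := by
  unfold marginalGen
  refine StronglyMeasurable.measurable (StronglyMeasurable.integral_prod_right
    (f := fun (u r : ℝ) => r ^ (-(1 / 2) : ℝ) * g (r + u)) (Measurable.stronglyMeasurable ?_))
  simp only [Function.uncurry_def]
  fun_prop

lemma measurable_lintegral_sq_add {g : ℝ → ℝ} (hm : Measurable g) :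
    Measurable fun q : ℝ => ∫⁻ v : ℝ, ENNReal.ofReal (g (v ^ 2 + q)) :=
  Measurable.lintegral_prod_right (by fun_prop)

variable {ι : Type*} [Fintype ι]

lemma lintegral_lintegral_sq_add {g : ℝ → ℝ} (hm : Measurable g) :
    ∫⁻ y : ι → ℝ, ∫⁻ v : ℝ, ENNReal.ofReal (g (v ^ 2 + y ⬝ᵥ y)) =
      ∫⁻ y : Unit ⊕ ι → ℝ, ENNReal.ofReal (g (y ⬝ᵥ y)) := by
  rw [lintegral_dotProduct_self_sum (h := fun r => ENNReal.ofReal (g r)) (by fun_prop),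
    lintegral_lintegral_swap (Measurable.aemeasurable (by fun_prop))]

/-- Both constants are reciprocals of the same (n + 1)-dimensional integral by Tonelli. Finiteness
makes the points where g⁽ⁿ⁾ takes its default value a null set. -/
lemma normConst_marginalGen {g : ℝ → ℝ} (hm : Measurable g) (g0 : ∀ u, 0 ≤ u → 0 ≤ g u)
    (hfin : ∫⁻ y : Unit ⊕ ι → ℝ, ENNReal.ofReal (g (y ⬝ᵥ y)) ≠ ∞) :
    normConst ι (marginalGen g) = normConst (Unit ⊕ ι) g := by
  rw [normConst_eq (by fun_prop) (marginalGen_nonneg g0), normConst_eq hm g0,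
    ← lintegral_lintegral_sq_add hm]
  rw [← lintegral_lintegral_sq_add hm] at hfin
  congr 2
  refine lintegral_congr_ae ?_
  filter_upwards [ae_lt_top (Measurable.lintegral_prod_right (by fun_prop)) hfin] with y hy
  rw [marginalGen_eq hm g0 (dotProduct_self_real_nonneg y), ENNReal.ofReal_toReal hy.ne]

lemma lintegral_funUnique {f : ℝ → ℝ≥0∞} (hf : Measurable f) :
    ∫⁻ y : Fin 1 → ℝ, f (y 0) = ∫⁻ v, f v :=
  (volume_preserving_funUnique (Fin 1) ℝ).lintegral_comp hf

lemma ofReal_ecCdf_condGen {g : ℝ → ℝ} (hm : Measurable g) (g0 : ∀ u, 0 ≤ u → 0 ≤ g u) {q : ℝ}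
    (hq : 0 ≤ q) (s : ℝ) (hz : ∫⁻ v : ℝ, ENNReal.ofReal (g (v ^ 2 + q)) ≠ 0)
    (ht : ∫⁻ v : ℝ, ENNReal.ofReal (g (v ^ 2 + q)) ≠ ∞) :
    ENNReal.ofReal (ecCdf (condGen g q) s) =
      (∫⁻ v : ℝ, ENNReal.ofReal (g (v ^ 2 + q)))⁻¹ *
        ∫⁻ v in Set.Iic s, ENNReal.ofReal (g (v ^ 2 + q)) := by
  set K := ∫⁻ v : ℝ, ENNReal.ofReal (g (v ^ 2 + q)) with hK
  have hcm : Measurable (condGen g q) := by unfold condGen; fun_prop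
  have hc0 : ∀ u, 0 ≤ u → 0 ≤ condGen g q u := fun u hu =>
    div_nonneg (g0 _ (add_nonneg hu hq)) (marginalGen_nonneg g0 q hq)
  have hmg : marginalGen g q = K.toReal := marginalGen_eq hm g0 hq
  have hval (v : ℝ) : ENNReal.ofReal (condGen g q (v ^ 2)) =
      K⁻¹ * ENNReal.ofReal (g (v ^ 2 + q)) := by
    rw [condGen, hmg, ENNReal.ofReal_div_of_pos (ENNReal.toReal_pos hz ht),
      ENNReal.ofReal_toReal ht, ENNReal.div_eq_inv_mul]
  have hdot (y : Fin 1 → ℝ) : y ⬝ᵥ y = y 0 ^ 2 := by simp [dotProduct, pow_two]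
  have hquad (y : Fin 1 → ℝ) : quad 0 (1 : Matrix (Fin 1) (Fin 1) ℝ) y = y 0 ^ 2 := by
    rw [quad_zero_eq, inv_one, one_mulVec, hdot]
  -- Division by g⁽ⁿ⁾(q) already normalizes g_q, so the constant of EC₁(0, 1, g_q) is 1.
  have hI : ∫⁻ y : Fin 1 → ℝ, ENNReal.ofReal (condGen g q (y ⬝ᵥ y)) = 1 := by
    simp only [hdot]
    rw [lintegral_funUnique (f := fun v => ENNReal.ofReal (condGen g q (v ^ 2))) (by fun_prop)]
    simp only [hval]
    rw [lintegral_const_mul _ (by fun_prop), ENNReal.inv_mul_cancel hz ht]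
  have hset : MeasurableSet {v : Fin 1 → ℝ | v 0 ≤ s} :=
    measurableSet_le (measurable_pi_apply 0) measurable_const
  have hmeas : ecLaw (0 : Fin 1 → ℝ) 1 (condGen g q) {v | v 0 ≤ s} =
      K⁻¹ * ∫⁻ v in Set.Iic s, ENNReal.ofReal (g (v ^ 2 + q)) := by
    rw [← lintegral_indicator_one hset, lintegral_ecLaw PosDef.one hcm hc0
      (measurable_one.indicator hset), ofReal_normConst hcm hc0 (by simp [hI]) (by simp [hI]), hI]
    have : (fun y : Fin 1 → ℝ => ENNReal.ofReal (condGen g q (quad 0 1 y)) *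
        {v : Fin 1 → ℝ | v 0 ≤ s}.indicator 1 y) = fun y => (Set.Iic s).indicator
          (fun v => K⁻¹ * ENNReal.ofReal (g (v ^ 2 + q))) (y 0) := by
      funext y
      rw [hquad, hval]
      by_cases hy : y 0 ≤ s <;> simp [Set.indicator, hy]
    rw [this, lintegral_funUnique (Measurable.indicator (by fun_prop) measurableSet_Iic),
      lintegral_indicator measurableSet_Iic, lintegral_const_mul _ (by fun_prop)]
    simp
  rw [ecCdf, Measure.real, hmeas, ENNReal.ofReal_toReal]
  refine ENNReal.mul_ne_top (ENNReal.inv_ne_top.mpr hz) (ne_top_of_le_ne_top ht ?_)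
  exact lintegral_mono' Measure.restrict_le_self le_rfl

end Marginal

/-! ### The skew density as a truncated integral -/

section SkewDensity

variable {n : ℕ} {g : ℝ → ℝ}

lemma ofReal_seDensity (hg : IsDensityGenerator (n + 1) g) (m α : Fin n → ℝ)
    {Om : Matrix (Fin n) (Fin n) ℝ} (hOm : Om.PosDef) (x : Fin n → ℝ)
    (ht : ∫⁻ v : ℝ, ENNReal.ofReal (g (v ^ 2 + quad m Om x)) ≠ ∞) :
    ENNReal.ofReal (seDensity m Om α g x) =
      2 * ENNReal.ofReal (normConst (Unit ⊕ Fin n) g * Om.det ^ (-(1 / 2) : ℝ)) *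
        ∫⁻ v in Set.Iic (α ⬝ᵥ ((scale Om)⁻¹ *ᵥ (x - m))),
          ENNReal.ofReal (g (v ^ 2 + quad m Om x)) := by
  have hm := hg.measurable
  have g0 := hg.nonneg
  have hq := quad_nonneg hOm m x
  have hc : 0 ≤ normConst (Unit ⊕ Fin n) g * Om.det ^ (-(1 / 2) : ℝ) :=
    mul_nonneg (normConst_nonneg g0) (Real.rpow_nonneg hOm.det_pos.le _)
  set s := α ⬝ᵥ ((scale Om)⁻¹ *ᵥ (x - m))
  set K := ∫⁻ v : ℝ, ENNReal.ofReal (g (v ^ 2 + quad m Om x)) with hK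
  have hmg : marginalGen g (quad m Om x) = K.toReal := marginalGen_eq hm g0 hq
  rw [seDensity, ecDensity, normConst_marginalGen hm g0 (lintegral_sum_ne hg).2, hmg]
  -- Where g⁽ⁿ⁾(q) = 0 the generator g_q is meaningless, but both sides vanish. Elsewhere K cancels
  -- K⁻¹.
  by_cases hz : K = 0
  · have hle : ∫⁻ v in Set.Iic s, ENNReal.ofReal (g (v ^ 2 + quad m Om x)) ≤ K :=
      lintegral_mono' Measure.restrict_le_self le_rfl
    rw [hz, nonpos_iff_eq_zero] at hle
    simp [hz, hle]
  · rw [ENNReal.ofReal_mul (by positivity), ENNReal.ofReal_mul (by positivity),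
      ENNReal.ofReal_mul hc, ENNReal.ofReal_toReal ht,
      ofReal_ecCdf_condGen hm g0 hq s hz ht, ← hK, ENNReal.ofReal_ofNat]
    set L := ∫⁻ v in Set.Iic s, ENNReal.ofReal (g (v ^ 2 + quad m Om x))
    set C := ENNReal.ofReal (normConst (Unit ⊕ Fin n) g * Om.det ^ (-(1 / 2) : ℝ))
    calc 2 * (C * K) * (K⁻¹ * L) = 2 * C * (K * K⁻¹) * L := by ring
      _ = _ := by rw [ENNReal.mul_inv_cancel hz ht, mul_one]

lemma measurable_lintegral_Iio_quad (hm : Measurable g) (Om : Matrix (Fin n) (Fin n) ℝ)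
    (β : Fin n → ℝ) :
    Measurable fun z : Fin n → ℝ =>
      ∫⁻ v in Set.Iio (β ⬝ᵥ z), ENNReal.ofReal (g (v ^ 2 + quad 0 Om z)) := by
  have hset : MeasurableSet {p : (Fin n → ℝ) × ℝ | p.2 < β ⬝ᵥ p.1} :=
    measurableSet_lt measurable_snd (by fun_prop)
  have hgm : Measurable fun p : (Fin n → ℝ) × ℝ => g (p.2 ^ 2 + quad 0 Om p.1) := by
    have : Continuous fun p : (Fin n → ℝ) × ℝ => p.2 ^ 2 + quad 0 Om p.1 := by fun_prop
    exact hm.comp this.measurable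
  have : (fun z : Fin n → ℝ =>
      ∫⁻ v in Set.Iio (β ⬝ᵥ z), ENNReal.ofReal (g (v ^ 2 + quad 0 Om z))) = fun z => ∫⁻ v,
        {p : (Fin n → ℝ) × ℝ | p.2 < β ⬝ᵥ p.1}.indicator
          (fun p => ENNReal.ofReal (g (p.2 ^ 2 + quad 0 Om p.1))) (z, v) := by
    funext z
    rw [← lintegral_indicator measurableSet_Iio]
    rfl
  rw [this]
  exact (hgm.ennreal_ofReal.indicator hset).lintegral_prod_right'

lemma lintegral_seLaw (hg : IsDensityGenerator (n + 1) g) (m α : Fin n → ℝ)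
    {Om : Matrix (Fin n) (Fin n) ℝ} (hOm : Om.PosDef) {β : Fin n → ℝ}
    (hβ : ∀ z, α ⬝ᵥ ((scale Om)⁻¹ *ᵥ z) = β ⬝ᵥ z) {f : (Fin n → ℝ) → ℝ≥0∞} (hf : Measurable f) :
    ∫⁻ x, f x ∂(seLaw m Om α g) =
      2 * ENNReal.ofReal (normConst (Unit ⊕ Fin n) g * Om.det ^ (-(1 / 2) : ℝ)) *
        ∫⁻ z, (∫⁻ v in Set.Iio (β ⬝ᵥ z), ENNReal.ofReal (g (v ^ 2 + quad 0 Om z))) * f (m + z) := by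
  have hm := hg.measurable
  have hL := measurable_lintegral_Iio_quad hm Om β
  set L : (Fin n → ℝ) → ℝ≥0∞ := fun z =>
    ∫⁻ v in Set.Iio (β ⬝ᵥ z), ENNReal.ofReal (g (v ^ 2 + quad 0 Om z)) with hLdef
  set C := 2 * ENNReal.ofReal (normConst (Unit ⊕ Fin n) g * Om.det ^ (-(1 / 2) : ℝ))
  -- This total is |Ω|^(1/2) times the (n + 1)-dimensional integral of g(y'y), so the inner integral
  -- is finite for almost every z.
  have hfin : ∫⁻ z, (fun q => ∫⁻ v : ℝ, ENNReal.ofReal (g (v ^ 2 + q))) (quad 0 Om z) ≠ ∞ := by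
    rw [lintegral_quad hOm (measurable_lintegral_sq_add hm), lintegral_lintegral_sq_add hm]
    exact ENNReal.mul_ne_top ENNReal.ofReal_ne_top (lintegral_sum_ne hg).2
  have hae0 : ∀ᵐ z : Fin n → ℝ, ∫⁻ v : ℝ, ENNReal.ofReal (g (v ^ 2 + quad 0 Om z)) < ∞ :=
    ae_lt_top ((measurable_lintegral_sq_add hm).comp (continuous_quad 0 Om).measurable) hfin
  have hae : ∀ᵐ x : Fin n → ℝ, ∫⁻ v : ℝ, ENNReal.ofReal (g (v ^ 2 + quad m Om x)) < ∞ := by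
    have := (measurePreserving_sub_right volume m).quasiMeasurePreserving.ae hae0
    simpa only [← quad_eq_quad_zero] using this
  have hdens : (fun x => ENNReal.ofReal (seDensity m Om α g x)) =ᵐ[volume]
      fun x => C * L (x - m) := by
    filter_upwards [hae] with x hx
    rw [ofReal_seDensity hg m α hOm x hx.ne, hβ, hLdef]
    simp only
    rw [← quad_eq_quad_zero, setLIntegral_congr Iio_ae_eq_Iic]
  rw [seLaw, withDensity_congr_ae hdens, lintegral_withDensity_eq_lintegral_mul _ (by fun_prop) hf,
    ← lintegral_add_left_eq_self _ m, ← lintegral_const_mul _ (f := fun z => L z * f (m + z))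
      (hL.mul (by fun_prop))]
  congr with z
  simp only [Pi.mul_apply, add_sub_cancel_left, mul_assoc]

lemma lintegral_eq_mul_lintegral_sub_mul {s : ℝ} (hs : 0 < s) (b : ℝ) {F : ℝ → ℝ≥0∞}
    (hF : Measurable F) : ∫⁻ v, F v = ENNReal.ofReal s * ∫⁻ u, F (b - s * u) := by
  rw [← lintegral_sub_left_eq_self F b]
  have h := Real.map_volume_mul_left hs.ne'
  rw [← lintegral_map (f := fun v => F (b - v)) (g := fun u => s * u) (by fun_prop) (by fun_prop), h,
    lintegral_smul_measure, smul_eq_mul, ← mul_assoc, ← ENNReal.ofReal_mul hs.le, abs_inv,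
    abs_of_pos hs, mul_inv_cancel₀ hs.ne']
  simp

/-- The additive representation: if `(u₀, u) ↦ (β'z - s u₀, z)`, with
`z = u₀ d + A u`, carries the quadratic forms to one another, then the skew law is that of `m + u₀ d + A u` given `u₀ > 0`. -/
lemma seLaw_eq_map_pairLaw (hg : IsDensityGenerator (n + 1) g) (m α : Fin n → ℝ)
    {Om : Matrix (Fin n) (Fin n) ℝ} (hOm : Om.PosDef) {β : Fin n → ℝ}
    (hβ : ∀ z, α ⬝ᵥ ((scale Om)⁻¹ *ᵥ z) = β ⬝ᵥ z) {Psi A : Matrix (Fin n) (Fin n) ℝ}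
    (hA : A.det ≠ 0) {s : ℝ} (hs : 0 < s) (d : Fin n → ℝ)
    (hquad : ∀ (r : ℝ) (u : Fin n → ℝ), (β ⬝ᵥ (r • d + A *ᵥ u) - s * r) ^ 2 +
      quad 0 Om (r • d + A *ᵥ u) = r ^ 2 + quad 0 Psi u)
    (hdet : Om.det ^ (-(1 / 2) : ℝ) * (s * |A.det|) = Psi.det ^ (-(1 / 2) : ℝ)) :
    seLaw m Om α g = (2 : ℝ≥0∞) • ((pairLaw Psi g).restrict {p | 0 < p.1}).map
      fun p => m + (p.1 • d + A *ᵥ p.2) := by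
  have hm := hg.measurable
  refine Measure.ext_of_lintegral _ fun f hf => ?_
  have hT : Measurable fun p : ℝ × (Fin n → ℝ) => m + (p.1 • d + A *ᵥ p.2) := by
    have : Continuous fun p : ℝ × (Fin n → ℝ) => m + (p.1 • d + A *ᵥ p.2) := by fun_prop
    exact this.measurable
  have hset : MeasurableSet {p : ℝ × (Fin n → ℝ) | 0 < p.1} :=
    measurableSet_lt measurable_const measurable_fst
  have hgOm : Measurable fun p : (Fin n → ℝ) × ℝ =>
      g ((β ⬝ᵥ p.1 - s * p.2) ^ 2 + quad 0 Om p.1) := by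
    have : Continuous fun p : (Fin n → ℝ) × ℝ =>
      (β ⬝ᵥ p.1 - s * p.2) ^ 2 + quad 0 Om p.1 := by fun_prop
    exact hm.comp this.measurable
  -- For fixed z, the substitution v = β'z - s r turns v < β'z into r > 0.
  have hinner (z : Fin n → ℝ) :
      (∫⁻ v in Set.Iio (β ⬝ᵥ z), ENNReal.ofReal (g (v ^ 2 + quad 0 Om z))) * f (m + z) =
        ENNReal.ofReal s * ∫⁻ r in Set.Ioi (0 : ℝ),
          ENNReal.ofReal (g ((β ⬝ᵥ z - s * r) ^ 2 + quad 0 Om z)) * f (m + z) := by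
    rw [← lintegral_indicator measurableSet_Iio, lintegral_eq_mul_lintegral_sub_mul hs (β ⬝ᵥ z)
      (Measurable.indicator (by fun_prop) measurableSet_Iio), mul_assoc,
      lintegral_mul_const _ (by fun_prop), ← lintegral_indicator measurableSet_Ioi]
    congr 3 with r
    have : β ⬝ᵥ z - s * r < β ⬝ᵥ z ↔ 0 < r := by
      rw [sub_lt_self_iff, mul_pos_iff_of_pos_left hs]
    by_cases hr : 0 < r <;> simp [Set.indicator, this, hr]
  -- After the order of integration is exchanged, z = r d + A u is substituted for fixed r; `hquad`
  -- then rewrites the argument of g.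
  have houter (r : ℝ) : ∫⁻ z, ENNReal.ofReal (g ((β ⬝ᵥ z - s * r) ^ 2 + quad 0 Om z)) * f (m + z) =
      ENNReal.ofReal |A.det| * ∫⁻ u, ENNReal.ofReal (g (r ^ 2 + quad 0 Psi u)) *
        f (m + (r • d + A *ᵥ u)) := by
    have hmz : Measurable fun z =>
        ENNReal.ofReal (g ((β ⬝ᵥ z - s * r) ^ 2 + quad 0 Om z)) * f (m + z) :=
      ((hgOm.comp measurable_prodMk_right).ennreal_ofReal).mul (by fun_prop)
    rw [← lintegral_add_left_eq_self _ (r • d), lintegral_eq_det_mul_lintegral_mulVec hA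
      (f := fun z => ENNReal.ofReal (g ((β ⬝ᵥ (r • d + z) - s * r) ^ 2 + quad 0 Om (r • d + z))) *
        f (m + (r • d + z))) (hmz.comp (measurable_const_add (r • d)))]
    simp only [hquad]
  have hc : 0 ≤ normConst (Unit ⊕ Fin n) g := normConst_nonneg hg.nonneg
  have hd := Real.rpow_nonneg hOm.det_pos.le (-(1 / 2) : ℝ)
  rw [lintegral_seLaw hg m α hOm hβ hf, lintegral_smul_measure, lintegral_map hf hT,
    ← lintegral_indicator hset, lintegral_pairLaw Psi hm (f := Set.indicator {p | 0 < p.1}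
      fun p => f (m + (p.1 • d + A *ᵥ p.2))) ((hf.comp hT).indicator hset)]
  simp only [hinner]
  have hswap : Measurable (Function.uncurry fun (z : Fin n → ℝ) (r : ℝ) =>
      ENNReal.ofReal (g ((β ⬝ᵥ z - s * r) ^ 2 + quad 0 Om z)) * f (m + z)) :=
    hgOm.ennreal_ofReal.mul (by fun_prop)
  rw [lintegral_const_mul _ (Measurable.lintegral_prod_right hswap),
    lintegral_lintegral_swap hswap.aemeasurable]
  simp only [houter]
  have hPsi : Measurable fun p : ℝ × (Fin n → ℝ) => g (p.1 ^ 2 + quad 0 Psi p.2) := by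
    have : Continuous fun p : ℝ × (Fin n → ℝ) => p.1 ^ 2 + quad 0 Psi p.2 := by fun_prop
    exact hm.comp this.measurable
  rw [lintegral_const_mul _ (Measurable.lintegral_prod_right
    (hPsi.ennreal_ofReal.mul (hf.comp hT))), ← lintegral_indicator measurableSet_Ioi, ← hdet,
    smul_eq_mul, ENNReal.ofReal_mul hc, ENNReal.ofReal_mul hc, ENNReal.ofReal_mul hd,
    ENNReal.ofReal_mul hs.le]
  have hfinal (r : ℝ) : (Set.Ioi (0 : ℝ)).indicator (fun r => ∫⁻ u,
      ENNReal.ofReal (g (r ^ 2 + quad 0 Psi u)) * f (m + (r • d + A *ᵥ u))) r =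
      ∫⁻ z, ENNReal.ofReal (g (r ^ 2 + quad 0 Psi z)) *
        {p : ℝ × (Fin n → ℝ) | 0 < p.1}.indicator (fun p => f (m + (p.1 • d + A *ᵥ p.2))) (r, z) := by
    by_cases hr : 0 < r <;> simp [Set.indicator, hr]
  simp only [hfinal]
  ring

end SkewDensity

/-! ### Congruences and rank-one perturbations of positive definite matrices -/

section RankOne

variable {ι : Type*} [Fintype ι] [DecidableEq ι]

lemma inv_congruence_mulVec {C M : Matrix ι ι ℝ} (hC : C.det ≠ 0) (v : ι → ℝ) :
    (C * M * Cᵀ)⁻¹ *ᵥ (C *ᵥ v) = (Cᵀ)⁻¹ *ᵥ (M⁻¹ *ᵥ v) := by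
  rw [Matrix.mul_inv_rev, Matrix.mul_inv_rev, mulVec_mulVec, Matrix.mul_assoc, Matrix.mul_assoc,
    nonsing_inv_mul _ (isUnit_iff_ne_zero.mpr hC), Matrix.mul_one, mulVec_mulVec]

lemma dotProduct_inv_congruence_mulVec {C M : Matrix ι ι ℝ} (hC : C.det ≠ 0) (v w : ι → ℝ) :
    (C *ᵥ w) ⬝ᵥ ((C * M * Cᵀ)⁻¹ *ᵥ (C *ᵥ v)) = w ⬝ᵥ (M⁻¹ *ᵥ v) := by
  rw [inv_congruence_mulVec hC, ← vecMul_transpose, ← dotProduct_mulVec, mulVec_mulVec,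
    mul_nonsing_inv _ (by simpa using hC), one_mulVec]

lemma posDef_congruence {C M : Matrix ι ι ℝ} (hC : C.det ≠ 0) (hM : M.PosDef) :
    (C * M * Cᵀ).PosDef := by
  have hinj : Function.Injective (fun v => v ᵥ* C) :=
    vecMul_injective_iff_isUnit.mpr ((isUnit_iff_isUnit_det C).mpr (isUnit_iff_ne_zero.mpr hC))
  simpa [conjTranspose_eq_transpose_of_trivial] using hM.mul_mul_conjTranspose_same hinj

omit [DecidableEq ι] in
lemma dotProduct_mulVec_comm_of_posDef {N : Matrix ι ι ℝ} (hN : N.PosDef) (v w : ι → ℝ) :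
    v ⬝ᵥ (N *ᵥ w) = w ⬝ᵥ (N *ᵥ v) := by
  have hT : Nᵀ = N := by simpa [conjTranspose_eq_transpose_of_trivial] using hN.isHermitian.eq
  rw [dotProduct_mulVec, ← mulVec_transpose, hT, dotProduct_comm]

/-- Sherman–Morrison: (N + dd')⁻¹ = N⁻¹ - (N⁻¹d)(N⁻¹d)' / (1 + d'N⁻¹d). The scaling N⁻¹d = sβ
absorbs the denominator s² and leaves N⁻¹ - ββ'. -/
lemma quad_add_vecMulVec {N : Matrix ι ι ℝ} (hN : N.PosDef) {d β : ι → ℝ} {s : ℝ}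
    (hs : s ≠ 0) (hs2 : s ^ 2 = 1 + d ⬝ᵥ (N⁻¹ *ᵥ d)) (hβ : N⁻¹ *ᵥ d = s • β) (z : ι → ℝ) :
    quad 0 (N + vecMulVec d d) z = quad 0 N z - (β ⬝ᵥ z) ^ 2 := by
  have hu : IsUnit N.det := isUnit_iff_ne_zero.mpr hN.det_pos.ne'
  have hNT : N⁻¹ᵀ = N⁻¹ := by
    simpa [conjTranspose_eq_transpose_of_trivial] using hN.inv.isHermitian.eq
  have hNβ : N *ᵥ β = s⁻¹ • d := by
    have := congrArg (fun v => N *ᵥ v) hβ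
    simp only [mulVec_mulVec, mul_nonsing_inv _ hu, one_mulVec, mulVec_smul] at this
    rw [this, smul_smul, inv_mul_cancel₀ hs, one_smul]
  have hdβ : d ⬝ᵥ β = s⁻¹ * (s ^ 2 - 1) := by
    rw [hs2, hβ, dotProduct_smul, smul_eq_mul]
    field_simp
    ring
  have hinv : (N + vecMulVec d d)⁻¹ = N⁻¹ - vecMulVec β β := by
    refine inv_eq_right_inv ?_
    rw [Matrix.add_mul, Matrix.mul_sub, Matrix.mul_sub, mul_nonsing_inv _ hu, mul_vecMulVec,
      vecMulVec_mul, vecMulVec_mul_vecMulVec, hNβ, ← mulVec_transpose, hNT, hβ, hdβ]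
    ext i j
    simp [vecMulVec_apply]
    field_simp
    ring
  rw [quad_zero_eq, quad_zero_eq, hinv, Matrix.sub_mulVec, vecMulVec_mulVec, dotProduct_sub]
  simp [dotProduct_comm z β, pow_two]

lemma det_add_vecMulVec {N : Matrix ι ι ℝ} (hN : N.PosDef) (d : ι → ℝ) :
    (N + vecMulVec d d).det = N.det * (1 + d ⬝ᵥ (N⁻¹ *ᵥ d)) := by
  rw [vecMulVec_eq Unit, det_add_replicateCol_mul_replicateRow
    (isUnit_iff_ne_zero.mpr hN.det_pos.ne')]
  congr 1
  simp [det_unique, Matrix.mul_assoc, Matrix.mul_apply, dotProduct, mulVec, Finset.mul_sum]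

-- Completing the square: with t = δ'x / s, the new form at x equals (x - tα)'R(x - tα) + t². If t =
-- 0 this is x'Rx > 0; otherwise t² > 0.
omit [DecidableEq ι] in
lemma posDef_sub_vecMulVec {R : Matrix ι ι ℝ} (hR : R.PosDef) {α δ : ι → ℝ} {s : ℝ}
    (hs : s ≠ 0) (hs2 : s ^ 2 = 1 + α ⬝ᵥ (R *ᵥ α)) (hδ : R *ᵥ α = s • δ) :
    (R - vecMulVec δ δ).PosDef := by
  have hT : Rᵀ = R := by simpa [conjTranspose_eq_transpose_of_trivial] using hR.isHermitian.eq
  refine PosDef.of_dotProduct_mulVec_pos ?_ fun x hx => ?_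
  · rw [IsHermitian, conjTranspose_eq_transpose_of_trivial, transpose_sub, transpose_vecMulVec, hT]
  set p := δ ⬝ᵥ x with hp
  set t := p / s with ht
  have hkey : (x - t • α) ⬝ᵥ (R *ᵥ (x - t • α)) = x ⬝ᵥ (R *ᵥ x) - p ^ 2 - t ^ 2 := by
    have h1 : α ⬝ᵥ (R *ᵥ x) = s * p := by
      rw [dotProduct_mulVec_comm_of_posDef hR, hδ, dotProduct_smul, dotProduct_comm, smul_eq_mul]
    have h2 : x ⬝ᵥ (R *ᵥ α) = s * p := by
      rw [hδ, dotProduct_smul, dotProduct_comm, smul_eq_mul]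
    have h3 : α ⬝ᵥ (R *ᵥ α) = s ^ 2 - 1 := by linarith
    simp only [mulVec_sub, mulVec_smul, dotProduct_sub, sub_dotProduct, dotProduct_smul,
      smul_dotProduct, h1, h2, h3, smul_eq_mul, ht]
    field_simp
    ring
  have hval : star x ⬝ᵥ ((R - vecMulVec δ δ) *ᵥ x) =
      (x - t • α) ⬝ᵥ (R *ᵥ (x - t • α)) + t ^ 2 := by
    rw [hkey, Matrix.sub_mulVec, vecMulVec_mulVec, dotProduct_sub]
    simp [dotProduct_comm x δ, ← hp, pow_two]
  rw [hval]
  by_cases htz : t = 0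
  · simpa [htz] using hR.dotProduct_mulVec_pos hx
  · have := hR.posSemidef.dotProduct_mulVec_nonneg (x - t • α)
    simp only [star_trivial] at this
    positivity

end RankOne

/-! ### Existence and uniqueness of (δ, Ψ), and the additive representation -/

section Params

variable {n : ℕ} {Om : Matrix (Fin n) (Fin n) ℝ}

lemma det_scale_ne_zero (hOm : Om.PosDef) : (scale Om).det ≠ 0 := by
  rw [scale, det_diagonal]
  exact Finset.prod_ne_zero_iff.mpr fun i _ => (Real.sqrt_pos.mpr hOm.diag_pos).ne'

lemma transpose_scale (Om : Matrix (Fin n) (Fin n) ℝ) : (scale Om)ᵀ = scale Om :=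
  diagonal_transpose _

lemma one_sub_sq_pos {x : ℝ} (hx : x ∈ Set.Ioo (-1 : ℝ) 1) : 0 < 1 - x ^ 2 := by
  nlinarith [hx.1, hx.2]

lemma det_deltaMat_ne_zero {δ : Fin n → ℝ} (hδ : ∀ i, δ i ∈ Set.Ioo (-1 : ℝ) 1) :
    (deltaMat δ).det ≠ 0 := by
  rw [deltaMat, det_diagonal]
  exact Finset.prod_ne_zero_iff.mpr fun i _ => (Real.sqrt_pos.mpr (one_sub_sq_pos (hδ i))).ne'

lemma transpose_deltaMat (δ : Fin n → ℝ) : (deltaMat δ)ᵀ = deltaMat δ :=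
  diagonal_transpose _

lemma deltaMat_mulVec_lam {δ : Fin n → ℝ} (hδ : ∀ i, δ i ∈ Set.Ioo (-1 : ℝ) 1) :
    deltaMat δ *ᵥ lam δ = δ := by
  rw [lam, mulVec_mulVec, mul_nonsing_inv _ (isUnit_iff_ne_zero.mpr (det_deltaMat_ne_zero hδ)),
    one_mulVec]

lemma scale_mul_corr_mul_scale (hOm : Om.PosDef) : scale Om * corr Om * scale Om = Om := by
  have hu : IsUnit (scale Om).det := isUnit_iff_ne_zero.mpr (det_scale_ne_zero hOm)
  rw [corr, Matrix.mul_assoc, Matrix.mul_assoc, nonsing_inv_mul _ hu, Matrix.mul_one,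
    ← Matrix.mul_assoc, mul_nonsing_inv _ hu, Matrix.one_mul]

lemma inv_scale (hOm : Om.PosDef) : (scale Om)⁻¹ = diagonal fun i => (√(Om i i))⁻¹ := by
  refine inv_eq_right_inv ?_
  rw [scale, diagonal_mul_diagonal, ← diagonal_one]
  congr 1
  funext i
  exact mul_inv_cancel₀ (Real.sqrt_pos.mpr hOm.diag_pos).ne'

lemma posDef_corr (hOm : Om.PosDef) : (corr Om).PosDef := by
  have hdet : ((scale Om)⁻¹).det ≠ 0 := by
    rw [det_nonsing_inv, Ring.inverse_eq_inv]
    exact inv_ne_zero (det_scale_ne_zero hOm)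
  have := posDef_congruence hdet hOm
  rwa [transpose_nonsing_inv, transpose_scale] at this

lemma corr_apply_self (hOm : Om.PosDef) (i : Fin n) : corr Om i i = 1 := by
  have hpos : 0 < Om i i := hOm.diag_pos
  rw [corr, inv_scale hOm, mul_diagonal, diagonal_mul]
  have := Real.mul_self_sqrt hpos.le
  have h0 := (Real.sqrt_pos.mpr hpos).ne'
  field_simp
  nlinarith

lemma IsAdditiveParam.scale_mul_eq (hOm : Om.PosDef) {α δ : Fin n → ℝ}
    {Psi : Matrix (Fin n) (Fin n) ℝ} (h : IsAdditiveParam Om α δ Psi) :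
    scale Om * deltaMat δ * Psi * deltaMat δ * scale Om =
      Om - vecMulVec (scale Om *ᵥ δ) (scale Om *ᵥ δ) := by
  have h1 := scale_mul_corr_mul_scale hOm
  rw [h.corr_eq, Matrix.mul_add, Matrix.add_mul, mul_vecMulVec, vecMulVec_mul,
    ← mulVec_transpose, transpose_scale] at h1
  rw [eq_sub_iff_add_eq]
  simpa only [Matrix.mul_assoc] using h1

/-- The factor `(1 + λ' Ψ⁻¹ λ)^(1/2)`. -/
def slant (δ : Fin n → ℝ) (Psi : Matrix (Fin n) (Fin n) ℝ) : ℝ :=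
  √(1 + lam δ ⬝ᵥ (Psi⁻¹ *ᵥ lam δ))

namespace IsAdditiveParam

variable {α δ : Fin n → ℝ} {Psi : Matrix (Fin n) (Fin n) ℝ} (h : IsAdditiveParam Om α δ Psi)

include h

lemma one_add_pos : 0 < 1 + lam δ ⬝ᵥ (Psi⁻¹ *ᵥ lam δ) := by
  have := h.posDef.inv.posSemidef.dotProduct_mulVec_nonneg (lam δ)
  simp only [star_trivial] at this
  positivity

lemma slant_pos : 0 < slant δ Psi := Real.sqrt_pos.mpr h.one_add_pos

lemma slant_sq : slant δ Psi ^ 2 = 1 + lam δ ⬝ᵥ (Psi⁻¹ *ᵥ lam δ) := Real.sq_sqrt h.one_add_pos.le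

lemma slant_smul_alpha :
    slant δ Psi • α = (deltaMat δ)⁻¹ *ᵥ (Psi⁻¹ *ᵥ lam δ) := by
  conv_lhs => rw [h.alpha_eq]
  exact smul_inv_smul₀ h.slant_pos.ne' _

/-- From the formula for α, ΔΨΔ(sα) = δ and δ'(sα) = λ'Ψ⁻¹λ = s² - 1. Adding the two parts of the
correlation matrix gives s⁻¹(1 + s² - 1)δ = sδ. -/
lemma corr_mulVec_alpha : corr Om *ᵥ α = slant δ Psi • δ := by
  have hD := det_deltaMat_ne_zero h.delta_mem
  have hs := h.slant_pos.ne'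
  have hα : α = (slant δ Psi)⁻¹ • ((deltaMat δ)⁻¹ *ᵥ (Psi⁻¹ *ᵥ lam δ)) := h.alpha_eq
  have hM : (deltaMat δ * Psi * deltaMat δ) *ᵥ ((deltaMat δ)⁻¹ *ᵥ (Psi⁻¹ *ᵥ lam δ)) = δ := by
    rw [← mulVec_mulVec, mulVec_mulVec _ (deltaMat δ) (deltaMat δ)⁻¹,
      mul_nonsing_inv _ (isUnit_iff_ne_zero.mpr hD), one_mulVec, ← mulVec_mulVec,
      mulVec_mulVec _ Psi, mul_nonsing_inv _ (isUnit_iff_ne_zero.mpr h.posDef.det_pos.ne'),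
      one_mulVec, deltaMat_mulVec_lam h.delta_mem]
  have hδ : δ ⬝ᵥ ((deltaMat δ)⁻¹ *ᵥ (Psi⁻¹ *ᵥ lam δ)) = slant δ Psi ^ 2 - 1 := by
    rw [h.slant_sq, dotProduct_mulVec, ← mulVec_transpose, transpose_nonsing_inv,
      transpose_deltaMat, ← lam]
    ring
  rw [h.corr_eq, Matrix.add_mulVec, vecMulVec_mulVec]
  conv_lhs => rw [hα, mulVec_smul, hM, dotProduct_smul, hδ]
  ext i
  simp
  field_simp
  ring

lemma dotProduct_corr_mulVec_alpha : α ⬝ᵥ (corr Om *ᵥ α) = slant δ Psi ^ 2 - 1 := by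
  have hs := h.slant_pos.ne'
  have hα : slant δ Psi * (δ ⬝ᵥ α) = slant δ Psi ^ 2 - 1 := by
    rw [← smul_eq_mul, ← dotProduct_smul, h.slant_smul_alpha, h.slant_sq, dotProduct_mulVec,
      ← mulVec_transpose, transpose_nonsing_inv, transpose_deltaMat, ← lam]
    ring
  rw [h.corr_mulVec_alpha, dotProduct_smul, dotProduct_comm, smul_eq_mul, hα]

/-- The right-hand side involves only Ω and α, which gives uniqueness of δ; `psi_eq` then gives that
of Ψ. -/
lemma delta_eq : δ = (√(1 + α ⬝ᵥ (corr Om *ᵥ α)))⁻¹ • (corr Om *ᵥ α) := by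
  rw [h.dotProduct_corr_mulVec_alpha, add_sub_cancel, Real.sqrt_sq h.slant_pos.le,
    h.corr_mulVec_alpha, inv_smul_smul₀ h.slant_pos.ne']

lemma psi_eq : Psi = (deltaMat δ)⁻¹ * (corr Om - vecMulVec δ δ) * (deltaMat δ)⁻¹ := by
  have hu := isUnit_iff_ne_zero.mpr (det_deltaMat_ne_zero h.delta_mem)
  rw [h.corr_eq, add_sub_cancel_right, Matrix.mul_assoc, Matrix.mul_assoc, mul_nonsing_inv _ hu,
    Matrix.mul_one, ← Matrix.mul_assoc, nonsing_inv_mul _ hu, Matrix.one_mul]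

end IsAdditiveParam

lemma exists_isAdditiveParam (hOm : Om.PosDef) (α : Fin n → ℝ) :
    ∃ δ Psi, IsAdditiveParam Om α δ Psi := by
  have hR := posDef_corr hOm
  have ha : 0 ≤ α ⬝ᵥ (corr Om *ᵥ α) := by
    simpa using hR.posSemidef.dotProduct_mulVec_nonneg α
  set s := √(1 + α ⬝ᵥ (corr Om *ᵥ α)) with hsdef
  have hs : 0 < s := Real.sqrt_pos.mpr (by positivity)
  have hs2 : s ^ 2 = 1 + α ⬝ᵥ (corr Om *ᵥ α) := Real.sq_sqrt (by positivity)
  -- The value forced by `IsAdditiveParam.delta_eq`.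
  set δ := s⁻¹ • (corr Om *ᵥ α) with hδdef
  have hδ : corr Om *ᵥ α = s • δ := (smul_inv_smul₀ hs.ne' _).symm
  set M := corr Om - vecMulVec δ δ with hMdef
  have hM : M.PosDef := posDef_sub_vecMulVec hR hs.ne' hs2 hδ
  have hMdiag (i : Fin n) : M i i = 1 - δ i ^ 2 := by
    simp [hMdef, corr_apply_self hOm, vecMulVec_apply, pow_two]
  -- The diagonal of the positive definite M is 1 - δᵢ², which puts δ in (-1, 1)ⁿ and gives Δ⁻¹MΔ⁻¹
  -- unit diagonal.
  have hδpos (i : Fin n) : 0 < 1 - δ i ^ 2 := hMdiag i ▸ hM.diag_pos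
  have hδmem (i : Fin n) : δ i ∈ Set.Ioo (-1 : ℝ) 1 :=
    abs_lt.mp ((sq_lt_one_iff_abs_lt_one _).mp (by linarith [hδpos i]))
  have hD := det_deltaMat_ne_zero hδmem
  have hu := isUnit_iff_ne_zero.mpr hD
  have hDi : ((deltaMat δ)⁻¹).det ≠ 0 := by
    rw [det_nonsing_inv, Ring.inverse_eq_inv]
    exact inv_ne_zero hD
  have hinv : (deltaMat δ)⁻¹ = diagonal fun i => (√(1 - δ i ^ 2))⁻¹ := by
    refine inv_eq_right_inv ?_
    rw [deltaMat, diagonal_mul_diagonal, ← diagonal_one]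
    congr 1
    funext i
    exact mul_inv_cancel₀ (Real.sqrt_pos.mpr (hδpos i)).ne'
  have hTi : ((deltaMat δ)⁻¹)ᵀ = (deltaMat δ)⁻¹ := by
    rw [transpose_nonsing_inv, transpose_deltaMat]
  set Psi := (deltaMat δ)⁻¹ * M * (deltaMat δ)⁻¹ with hPsi
  have hPD : Psi.PosDef := by
    have := posDef_congruence hDi hM
    rwa [hTi] at this
  have hMPsi : deltaMat δ * Psi * deltaMat δ = M := by
    rw [hPsi, Matrix.mul_assoc, Matrix.mul_assoc, nonsing_inv_mul _ hu, Matrix.mul_one,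
      ← Matrix.mul_assoc, mul_nonsing_inv _ hu, Matrix.one_mul]
  have hδα : δ ⬝ᵥ α = s⁻¹ * (s ^ 2 - 1) := by
    rw [hδdef, smul_dotProduct, dotProduct_comm, hs2, add_sub_cancel_left, smul_eq_mul]
  -- Equivalently sα = M⁻¹δ; with M = ΔΨΔ and δ = Δλ this is the required formula for α.
  have hMα : M *ᵥ (s • α) = δ := by
    rw [mulVec_smul, hMdef, Matrix.sub_mulVec, vecMulVec_mulVec, hδ, hδα]
    ext i
    simp
    field_simp
    ring
  have hMinv : M⁻¹ *ᵥ δ = s • α := by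
    rw [← hMα, mulVec_mulVec, nonsing_inv_mul _ (isUnit_iff_ne_zero.mpr hM.det_pos.ne'), one_mulVec]
  have hM' : M = deltaMat δ * Psi * (deltaMat δ)ᵀ := by rw [transpose_deltaMat, hMPsi]
  have hvec : (deltaMat δ)⁻¹ *ᵥ (Psi⁻¹ *ᵥ lam δ) = s • α := by
    have := inv_congruence_mulVec (M := Psi) hD (lam δ)
    rw [← hM', deltaMat_mulVec_lam hδmem, hMinv, transpose_deltaMat] at this
    exact this.symm
  have hquad : lam δ ⬝ᵥ (Psi⁻¹ *ᵥ lam δ) = s ^ 2 - 1 := by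
    have := dotProduct_inv_congruence_mulVec (M := Psi) hD (lam δ) (lam δ)
    rw [← hM', deltaMat_mulVec_lam hδmem, hMinv, dotProduct_smul, hδα, smul_eq_mul,
      mul_inv_cancel_left₀ hs.ne'] at this
    exact this.symm
  refine ⟨δ, Psi, hδmem, hPD, fun i => ?_, ?_, ?_⟩
  · rw [hPsi, hinv, mul_diagonal, diagonal_mul, hMdiag]
    have h1 := Real.mul_self_sqrt (hδpos i).le
    have h0 := (Real.sqrt_pos.mpr (hδpos i)).ne'
    field_simp
    nlinarith
  · rw [hMPsi, hMdef, sub_add_cancel]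
  · rw [hquad, hvec, add_sub_cancel, Real.sqrt_sq hs.le, inv_smul_smul₀ hs.ne']

lemma existsUnique_isAdditiveParam (hOm : Om.PosDef) (α : Fin n → ℝ) :
    ∃! p : (Fin n → ℝ) × Matrix (Fin n) (Fin n) ℝ, IsAdditiveParam Om α p.1 p.2 := by
  obtain ⟨δ, Psi, h⟩ := exists_isAdditiveParam hOm α
  refine ⟨(δ, Psi), h, ?_⟩
  rintro ⟨δ', Psi'⟩ h'
  have h1 : δ' = δ := h'.delta_eq.trans h.delta_eq.symm
  subst h1
  exact Prod.ext rfl (h'.psi_eq.trans h.psi_eq.symm)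

lemma IsAdditiveParam.seLaw_eq {g : ℝ → ℝ} (hg : IsDensityGenerator (n + 1) g) (hOm : Om.PosDef)
    (m : Fin n → ℝ) {α δ : Fin n → ℝ} {Psi : Matrix (Fin n) (Fin n) ℝ}
    (h : IsAdditiveParam Om α δ Psi) :
    seLaw m Om α g = (2 : ℝ≥0∞) • ((pairLaw Psi g).restrict {p | 0 < p.1}).map
      fun p => m + (p.1 • (scale Om *ᵥ δ) + (scale Om * deltaMat δ) *ᵥ p.2) := by
  set A := scale Om * deltaMat δ with hAdef
  set d := scale Om *ᵥ δ with hd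
  set s := slant δ Psi with hsdef
  have hs : 0 < s := h.slant_pos
  have hA : A.det ≠ 0 := by
    rw [hAdef, det_mul]
    exact mul_ne_zero (det_scale_ne_zero hOm) (det_deltaMat_ne_zero h.delta_mem)
  have hAT : Aᵀ = deltaMat δ * scale Om := by
    rw [hAdef, transpose_mul, transpose_scale, transpose_deltaMat]
  have hdA : d = A *ᵥ lam δ := by
    rw [hAdef, ← mulVec_mulVec, deltaMat_mulVec_lam h.delta_mem]
  have hN : (A * Psi * Aᵀ).PosDef := posDef_congruence hA h.posDef
  have hOmN : Om = A * Psi * Aᵀ + vecMulVec d d := by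
    rw [eq_comm, ← eq_sub_iff_add_eq, hAT, ← Matrix.mul_assoc, hd, ← h.scale_mul_eq hOm]
  have hs2 : s ^ 2 = 1 + d ⬝ᵥ ((A * Psi * Aᵀ)⁻¹ *ᵥ d) := by
    rw [hdA, dotProduct_inv_congruence_mulVec hA, h.slant_sq]
  have hβN : (A * Psi * Aᵀ)⁻¹ *ᵥ d = s • ((scale Om)⁻¹ *ᵥ α) := by
    rw [hdA, inv_congruence_mulVec hA, hAT, Matrix.mul_inv_rev, ← mulVec_mulVec,
      ← h.slant_smul_alpha, mulVec_smul]
  set β := (scale Om)⁻¹ *ᵥ α with hβdef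
  have hdet : Om.det = (s * |A.det|) ^ 2 * Psi.det := by
    conv_lhs => rw [hOmN, det_add_vecMulVec hN, ← hs2]
    rw [det_mul, det_mul, det_transpose, mul_pow, sq_abs]
    ring
  have hdβ : s * (d ⬝ᵥ β) = s ^ 2 - 1 := by
    rw [← smul_eq_mul, ← dotProduct_smul, ← hβN, hs2]
    ring
  refine seLaw_eq_map_pairLaw hg m α hOm (β := β) (fun z => ?_) hA hs d (fun r u => ?_) ?_
  · rw [hβdef, dotProduct_mulVec, ← mulVec_transpose, transpose_nonsing_inv, transpose_scale]
  -- With N = AΨA', N⁻¹d = sβ produces the cross term and d'N⁻¹d = s² - 1 the r² term. Passing from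
  -- N to Ω subtracts (β'z)², which cancels the leading term of (β'z - s r)²; what remains is r² +
  -- u'Ψ⁻¹u.
  · have hq : quad 0 (A * Psi * Aᵀ) (r • d + A *ᵥ u) =
        r ^ 2 * (s ^ 2 - 1) + 2 * r * s * (β ⬝ᵥ (A *ᵥ u)) + quad 0 Psi u := by
      have h1 : d ⬝ᵥ ((A * Psi * Aᵀ)⁻¹ *ᵥ d) = s ^ 2 - 1 := by linarith
      have h2 : (A *ᵥ u) ⬝ᵥ ((A * Psi * Aᵀ)⁻¹ *ᵥ d) = s * (β ⬝ᵥ (A *ᵥ u)) := by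
        rw [hβN, dotProduct_smul, dotProduct_comm, smul_eq_mul]
      have h3 : d ⬝ᵥ ((A * Psi * Aᵀ)⁻¹ *ᵥ (A *ᵥ u)) = s * (β ⬝ᵥ (A *ᵥ u)) := by
        rw [dotProduct_mulVec_comm_of_posDef hN.inv, h2]
      have h4 : (A *ᵥ u) ⬝ᵥ ((A * Psi * Aᵀ)⁻¹ *ᵥ (A *ᵥ u)) = u ⬝ᵥ (Psi⁻¹ *ᵥ u) :=
        dotProduct_inv_congruence_mulVec hA u u
      rw [quad_zero_eq, quad_zero_eq]
      simp only [mulVec_add, mulVec_smul, add_dotProduct, dotProduct_add, smul_dotProduct,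
        dotProduct_smul, h1, h2, h3, h4, smul_eq_mul]
      ring
    have hquad := quad_add_vecMulVec hN hs.ne' hs2 hβN (r • d + A *ᵥ u)
    rw [← hOmN] at hquad
    rw [hquad, hq, dotProduct_add, dotProduct_smul, dotProduct_comm β d, smul_eq_mul]
    linear_combination (-2 * r ^ 2) * hdβ
  · have hk : 0 < s * |A.det| := mul_pos hs (abs_pos.mpr hA)
    rw [hdet, Real.mul_rpow (by positivity) h.posDef.det_pos.le, ← Real.rpow_natCast,
      ← Real.rpow_mul hk.le]
    norm_num
    rw [Real.rpow_neg_one]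
    field_simp

end Params

/-! ### Characteristic functions of centred elliptical laws -/

section CharFun

variable {ι : Type*} [Fintype ι]

@[fun_prop]
lemma continuous_exp_dotProduct (t : ι → ℝ) :
    Continuous fun u : ι → ℝ => Complex.exp (Complex.I * ((t ⬝ᵥ u : ℝ) : ℂ)) := by
  fun_prop

lemma norm_exp_I_mul_ofReal (r : ℝ) : ‖Complex.exp (Complex.I * (r : ℂ))‖ = 1 := by
  rw [mul_comm]
  exact Complex.norm_exp_ofReal_mul_I r

variable [DecidableEq ι]

/-- A linear involution has determinant ±1, hence preserves Lebesgue measure; preserving the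
quadratic form, it preserves the density as well. -/
lemma map_mulVec_ecLaw {Psi H : Matrix ι ι ℝ} {h : ℝ → ℝ} (hm : Measurable h) (hH : H * H = 1)
    (hq : ∀ u, quad 0 Psi (H *ᵥ u) = quad 0 Psi u) :
    (ecLaw 0 Psi h).map (fun u => H *ᵥ u) = ecLaw 0 Psi h := by
  have hdet2 : H.det * H.det = 1 := by rw [← det_mul, hH, det_one]
  have hdet : H.det ≠ 0 := left_ne_zero_of_mul_eq_one hdet2
  have habs : |H.det| = 1 := by
    rcases mul_self_eq_one_iff.mp hdet2 with h1 | h1 <;> simp [h1]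
  have hHm : Measurable fun u : ι → ℝ => H *ᵥ u := by
    have : Continuous fun u : ι → ℝ => H *ᵥ u := by fun_prop
    exact this.measurable
  have hd : Measurable fun x => ENNReal.ofReal (ecDensity 0 Psi h x) :=
    (measurable_ecDensity 0 Psi hm).ennreal_ofReal
  refine Measure.ext_of_lintegral _ fun f hf => ?_
  rw [lintegral_map hf hHm, ecLaw,
    lintegral_withDensity_eq_lintegral_mul _ hd (g := fun u => f (H *ᵥ u)) (hf.comp hHm),
    lintegral_withDensity_eq_lintegral_mul _ hd hf,
    lintegral_eq_det_mul_lintegral_mulVec hdet (hd.mul hf), habs]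
  simp [ecDensity, hq]

lemma integral_exp_ecLaw_mulVec {Psi H : Matrix ι ι ℝ} {h : ℝ → ℝ} (hm : Measurable h)
    (hH : H * H = 1) (hq : ∀ u, quad 0 Psi (H *ᵥ u) = quad 0 Psi u) (t : ι → ℝ) :
    ∫ u, Complex.exp (Complex.I * ((t ⬝ᵥ (H *ᵥ u) : ℝ) : ℂ)) ∂(ecLaw 0 Psi h) =
      ∫ u, Complex.exp (Complex.I * ((t ⬝ᵥ u : ℝ) : ℂ)) ∂(ecLaw 0 Psi h) := by
  have hHc : Continuous fun u : ι → ℝ => H *ᵥ u := by fun_prop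
  conv_rhs => rw [← map_mulVec_ecLaw hm hH hq]
  rw [integral_map hHc.measurable.aemeasurable
    (continuous_exp_dotProduct t).aestronglyMeasurable]

/-- The symmetry u ↦ -u makes the characteristic function equal to its conjugate. -/
lemma integral_exp_ecLaw_eq_re {Psi : Matrix ι ι ℝ} {h : ℝ → ℝ} (hm : Measurable h) (t : ι → ℝ) :
    (((∫ u, Complex.exp (Complex.I * ((t ⬝ᵥ u : ℝ) : ℂ)) ∂(ecLaw 0 Psi h)).re : ℝ) : ℂ) =
      ∫ u, Complex.exp (Complex.I * ((t ⬝ᵥ u : ℝ) : ℂ)) ∂(ecLaw 0 Psi h) := by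
  rw [← Complex.conj_eq_iff_re, ← integral_conj,
    ← integral_exp_ecLaw_mulVec hm (H := -1) (by simp) (fun u => by
      rw [Matrix.neg_mulVec, one_mulVec]
      simp [quad_zero_eq, mulVec_neg])]
  congr with u
  rw [← Complex.exp_conj]
  simp [Matrix.neg_mulVec]

/-- If t and s have the same Ψ-length, a reflection that preserves u'Ψ⁻¹u carries the functional t'u
to s'u, and the law is invariant under it. -/
lemma integral_exp_ecLaw_congr {Psi : Matrix ι ι ℝ} (hP : Psi.PosDef) {h : ℝ → ℝ}
    (hm : Measurable h) {t s : ι → ℝ} (hts : t ⬝ᵥ (Psi *ᵥ t) = s ⬝ᵥ (Psi *ᵥ s)) :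
    ∫ u, Complex.exp (Complex.I * ((t ⬝ᵥ u : ℝ) : ℂ)) ∂(ecLaw 0 Psi h) =
      ∫ u, Complex.exp (Complex.I * ((s ⬝ᵥ u : ℝ) : ℂ)) ∂(ecLaw 0 Psi h) := by
  by_cases hw : t - s = 0
  · rw [sub_eq_zero.mp hw]
  set w := t - s with hwdef
  have hu : IsUnit Psi.det := isUnit_iff_ne_zero.mpr hP.det_pos.ne'
  set k := w ⬝ᵥ (Psi *ᵥ w) with hk
  have hk0 : k ≠ 0 := by
    have := hP.dotProduct_mulVec_pos hw
    simp only [star_trivial] at this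
    exact this.ne'
  -- The equal lengths of t and s enter here: this is what makes the reflection exchange them.
  have htw : 2 * (t ⬝ᵥ (Psi *ᵥ w)) = k := by
    have hc := dotProduct_mulVec_comm_of_posDef hP t s
    simp only [hk, hwdef, mulVec_sub, dotProduct_sub, sub_dotProduct]
    linarith
  -- The Householder reflection along Ψw, orthogonal for the form Ψ⁻¹.
  set H : Matrix ι ι ℝ := 1 - (2 / k) • vecMulVec (Psi *ᵥ w) w with hHdef
  have hHu (u : ι → ℝ) : H *ᵥ u = u - (2 / k * (w ⬝ᵥ u)) • (Psi *ᵥ w) := by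
    rw [hHdef, Matrix.sub_mulVec, one_mulVec, Matrix.smul_mulVec, vecMulVec_mulVec]
    ext i
    simp
    ring
  have hH2 : H * H = 1 := by
    rw [hHdef, Matrix.sub_mul, Matrix.mul_sub, Matrix.mul_sub, Matrix.one_mul, Matrix.mul_one,
      Matrix.one_mul, Matrix.smul_mul, Matrix.mul_smul, vecMulVec_mul_vecMulVec, ← hk]
    ext i j
    simp [vecMulVec_apply]
    field_simp
    ring
  have hq (u : ι → ℝ) : quad 0 Psi (H *ᵥ u) = quad 0 Psi u := by
    have h1 : Psi⁻¹ *ᵥ (Psi *ᵥ w) = w := by rw [mulVec_mulVec, nonsing_inv_mul _ hu, one_mulVec]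
    have h2 : (Psi *ᵥ w) ⬝ᵥ (Psi⁻¹ *ᵥ u) = w ⬝ᵥ u := by
      rw [dotProduct_mulVec_comm_of_posDef hP.inv, h1, dotProduct_comm]
    have h3 : (Psi *ᵥ w) ⬝ᵥ w = k := by rw [dotProduct_comm]
    rw [quad_zero_eq, quad_zero_eq, hHu]
    simp only [mulVec_sub, mulVec_smul, dotProduct_sub, sub_dotProduct, dotProduct_smul,
      smul_dotProduct, h1, h2, h3, smul_eq_mul, dotProduct_comm u w]
    field_simp
    ring
  rw [← integral_exp_ecLaw_mulVec hm hH2 hq t]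
  congr with u
  have : t ⬝ᵥ (H *ᵥ u) = s ⬝ᵥ u := by
    rw [hHu, dotProduct_sub, dotProduct_smul, smul_eq_mul]
    have h4 : t ⬝ᵥ (Psi *ᵥ w) = k / 2 := by linarith
    rw [h4]
    have h5 : w ⬝ᵥ u = t ⬝ᵥ u - s ⬝ᵥ u := by rw [hwdef, sub_dotProduct]
    rw [h5]
    field_simp
    ring
  rw [this]

end CharFun

/-! ### Disintegration over U₀ and the characteristic function of X -/

section Main

variable {n : ℕ} {g : ℝ → ℝ} {Psi : Matrix (Fin n) (Fin n) ℝ}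
  {T : Type*} [MeasurableSpace T] {Q : Measure T} [IsProbabilityMeasure Q]
  {U₀ : T → ℝ} {U : T → Fin n → ℝ}

omit [IsProbabilityMeasure Q] in
lemma hasLaw_pairLaw (hg : IsDensityGenerator (n + 1) g) (hP : Psi.PosDef)
    (h : HasLaw (fun w => Sum.elim (fun _ : Unit => U₀ w) (U w))
      (ecLaw (0 : Unit ⊕ Fin n → ℝ) (fromBlocks 1 0 0 Psi) g) Q) :
    HasLaw (fun w => (U₀ w, U w)) (pairLaw Psi g) Q where
  aemeasurable := (pairEquiv (Fin n)).measurable.comp_aemeasurable h.aemeasurable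
  map_eq := by
    rw [← map_pairEquiv_ecLaw hP hg.measurable hg.nonneg, ← h.map_eq,
      AEMeasurable.map_map_of_aemeasurable (pairEquiv (Fin n)).measurable.aemeasurable
        h.aemeasurable]
    rfl

omit [IsProbabilityMeasure Q] in
lemma map_fst_pairLaw (h : HasLaw (fun w => (U₀ w, U w)) (pairLaw Psi g) Q) :
    (pairLaw Psi g).map Prod.fst = Q.map U₀ := by
  rw [← h.map_eq, AEMeasurable.map_map_of_aemeasurable measurable_fst.aemeasurable h.aemeasurable]
  rfl

/-- Almost everywhere uniqueness of the disintegration, applied to the explicit kernel. -/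
lemma ae_condDistrib_eq_ecLaw (hg : IsDensityGenerator (n + 1) g) (hP : Psi.PosDef)
    (h : HasLaw (fun w => (U₀ w, U w)) (pairLaw Psi g) Q) :
    ∀ᵐ u₀ ∂(Q.map U₀), condDistrib U U₀ Q u₀ = ecLaw 0 Psi (fun u => g (u + u₀ ^ 2)) := by
  have := isFiniteKernel_condKernelEC hP hg.measurable hg.nonneg
  have : IsProbabilityMeasure (pairLaw Psi g) := h.isProbabilityMeasure_iff.mp inferInstance
  have hU : AEMeasurable U Q := measurable_snd.comp_aemeasurable h.aemeasurable
  have hc := condDistrib_ae_eq_of_measure_eq_compProd U₀ hU (κ := condKernelEC Psi g) (by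
    rw [h.map_eq, ← map_fst_pairLaw h]
    exact pairLaw_eq_compProd hg hP)
  filter_upwards [hc] with u₀ hu₀
  rw [hu₀, condKernelEC_apply Psi hg.measurable]

lemma exists_isCondCharGenerator (hg : IsDensityGenerator (n + 1) g) (hP : Psi.PosDef)
    (h : HasLaw (fun w => (U₀ w, U w)) (pairLaw Psi g) Q) :
    ∃ φ : ℝ → ℝ → ℝ, IsCondCharGenerator Q U₀ U Psi φ := by
  classical
  have hm := hg.measurable
  -- The value at r is read off at any t with t'Ψt = r, and is immaterial at an r that is not
  -- attained. Independence of the choice of t is `integral_exp_ecLaw_congr`.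
  refine ⟨fun u₀ r => if hr : ∃ t : Fin n → ℝ, t ⬝ᵥ (Psi *ᵥ t) = r then
    (∫ u, Complex.exp (Complex.I * ((hr.choose ⬝ᵥ u : ℝ) : ℂ))
      ∂(ecLaw 0 Psi fun v => g (v + u₀ ^ 2))).re else 0, ?_⟩
  filter_upwards [ae_condDistrib_eq_ecLaw hg hP h] with u₀ hu₀ t
  have hr : ∃ t' : Fin n → ℝ, t' ⬝ᵥ (Psi *ᵥ t') = t ⬝ᵥ (Psi *ᵥ t) := ⟨t, rfl⟩
  rw [hu₀, dif_pos hr, integral_exp_ecLaw_eq_re (by fun_prop)]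
  exact integral_exp_ecLaw_congr hP (by fun_prop) hr.choose_spec.symm

variable {Om : Matrix (Fin n) (Fin n) ℝ} {α δ : Fin n → ℝ}

/-- No measurability of φ in u₀ is assumed. The integrand agrees almost everywhere with the
conditional integral of a bounded continuous function of (u₀, u), and inherits integrability from
it. -/
lemma IsAdditiveParam.integrableOn_and_integral_exp (hg : IsDensityGenerator (n + 1) g)
    (hOm : Om.PosDef) (m : Fin n → ℝ) (hp : IsAdditiveParam Om α δ Psi)
    (h : HasLaw (fun w => (U₀ w, U w)) (pairLaw Psi g) Q)
    {φ : ℝ → ℝ → ℝ} (hφ : IsCondCharGenerator Q U₀ U Psi φ) (t : Fin n → ℝ) :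
    IntegrableOn (fun u₀ : ℝ =>
        Complex.exp (Complex.I * (((t ⬝ᵥ (scale Om *ᵥ δ)) * u₀ : ℝ) : ℂ)) *
          ((φ u₀ (t ⬝ᵥ ((scale Om * deltaMat δ * Psi * deltaMat δ * scale Om) *ᵥ t)) : ℝ) : ℂ))
      (Set.Ioi 0) (Q.map U₀) ∧
    ∫ x, Complex.exp (Complex.I * ((t ⬝ᵥ x : ℝ) : ℂ)) ∂(seLaw m Om α g) =
      2 * Complex.exp (Complex.I * ((t ⬝ᵥ m : ℝ) : ℂ)) * ∫ u₀ in Set.Ioi (0 : ℝ),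
        Complex.exp (Complex.I * (((t ⬝ᵥ (scale Om *ᵥ δ)) * u₀ : ℝ) : ℂ)) *
          ((φ u₀ (t ⬝ᵥ ((scale Om * deltaMat δ * Psi * deltaMat δ * scale Om) *ᵥ t)) : ℝ) : ℂ)
        ∂(Q.map U₀) := by
  have hU₀ : AEMeasurable U₀ Q := measurable_fst.comp_aemeasurable h.aemeasurable
  have hU : AEMeasurable U Q := measurable_snd.comp_aemeasurable h.aemeasurable
  have : IsProbabilityMeasure (Q.map U₀) := Measure.isProbabilityMeasure_map hU₀
  have hdis : Q.map U₀ ⊗ₘ condDistrib U U₀ Q = pairLaw Psi g := by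
    rw [compProd_map_condDistrib hU, h.map_eq]
  set d := scale Om *ᵥ δ
  set A := scale Om * deltaMat δ with hA
  set F : ℝ × (Fin n → ℝ) → ℂ := fun p => Complex.exp (Complex.I * (((t ⬝ᵥ d) * p.1 : ℝ) : ℂ)) *
    Complex.exp (Complex.I * (((Aᵀ *ᵥ t) ⬝ᵥ p.2 : ℝ) : ℂ)) with hF
  have hFc : Continuous F := by fun_prop
  have hFint : Integrable F (Q.map U₀ ⊗ₘ condDistrib U U₀ Q) := by
    refine Integrable.of_bound hFc.aestronglyMeasurable 1 (Filter.Eventually.of_forall fun p => ?_)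
    rw [hF, norm_mul, norm_exp_I_mul_ofReal, norm_exp_I_mul_ofReal, one_mul]
  have hquad : (Aᵀ *ᵥ t) ⬝ᵥ (Psi *ᵥ (Aᵀ *ᵥ t)) =
      t ⬝ᵥ ((A * Psi * deltaMat δ * scale Om) *ᵥ t) := by
    have hAT : Aᵀ = deltaMat δ * scale Om := by
      rw [hA, transpose_mul, transpose_scale, transpose_deltaMat]
    rw [mulVec_transpose, ← dotProduct_mulVec, ← mulVec_transpose, hAT]
    simp only [mulVec_mulVec, Matrix.mul_assoc]
  -- The conditional characteristic function is evaluated at A't, where its argument is (A't)'Ψ(A't)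
  -- = t'ωΔΨΔωt.
  have hinner : ∀ᵐ u₀ ∂(Q.map U₀), ∫ u, F (u₀, u) ∂(condDistrib U U₀ Q u₀) =
      Complex.exp (Complex.I * (((t ⬝ᵥ d) * u₀ : ℝ) : ℂ)) *
        ((φ u₀ (t ⬝ᵥ ((A * Psi * deltaMat δ * scale Om) *ᵥ t)) : ℝ) : ℂ) := by
    filter_upwards [hφ] with u₀ hu₀
    rw [← hquad, ← hu₀, ← integral_const_mul]
  refine ⟨(hFint.integral_compProd.congr hinner).integrableOn, ?_⟩
  rw [← setIntegral_congr_ae measurableSet_Ioi (hinner.mono fun _ hx _ => hx)]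
  have hset : {p : ℝ × (Fin n → ℝ) | 0 < p.1} = Set.Ioi 0 ×ˢ Set.univ := by
    ext p
    simp
  have hprod := Measure.setIntegral_compProd (measurableSet_Ioi (a := (0 : ℝ)))
    (MeasurableSet.univ (α := Fin n → ℝ)) hFint.integrableOn
  simp only [Measure.restrict_univ] at hprod
  have hT : Continuous fun p : ℝ × (Fin n → ℝ) => m + (p.1 • d + A *ᵥ p.2) := by fun_prop
  rw [← hprod, hdis, hp.seLaw_eq hg hOm m, integral_smul_measure,
    integral_map hT.measurable.aemeasurable (continuous_exp_dotProduct t).aestronglyMeasurable,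
    hset, mul_assoc, ← integral_const_mul]
  have hexp (p : ℝ × (Fin n → ℝ)) :
      Complex.exp (Complex.I * ((t ⬝ᵥ (m + (p.1 • d + A *ᵥ p.2)) : ℝ) : ℂ)) =
        Complex.exp (Complex.I * ((t ⬝ᵥ m : ℝ) : ℂ)) * F p := by
    have h1 : t ⬝ᵥ (m + (p.1 • d + A *ᵥ p.2)) =
        t ⬝ᵥ m + ((t ⬝ᵥ d) * p.1 + (Aᵀ *ᵥ t) ⬝ᵥ p.2) := by
      rw [dotProduct_add, dotProduct_add, dotProduct_smul, smul_eq_mul, mulVec_transpose,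
        ← dotProduct_mulVec, mul_comm p.1]
    simp only [h1, hF]
    rw [← Complex.exp_add, ← Complex.exp_add]
    push_cast
    ring_nf
  simp only [hexp]
  simp

end Main

end SkewElliptical

end

theorem theorem3p2 {n : ℕ} (hn : 0 < n)
    (μ α : Fin n → ℝ) (Om : Matrix (Fin n) (Fin n) ℝ) (hOm : Om.PosDef)
    (g : ℝ → ℝ) (hg : SkewElliptical.IsDensityGenerator (n + 1) g)
    {S : Type*} [MeasurableSpace S] (P : Measure S) [IsProbabilityMeasure P]
    (X : S → Fin n → ℝ) (hX : HasLaw X (SkewElliptical.seLaw μ Om α g) P) :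
    (∃! p : (Fin n → ℝ) × Matrix (Fin n) (Fin n) ℝ,
      SkewElliptical.IsAdditiveParam Om α p.1 p.2) ∧
    ∀ (δ : Fin n → ℝ) (Psi : Matrix (Fin n) (Fin n) ℝ),
      SkewElliptical.IsAdditiveParam Om α δ Psi →
      SkewElliptical.scale Om * SkewElliptical.deltaMat δ * Psi *
          SkewElliptical.deltaMat δ * SkewElliptical.scale Om =
        Om - Matrix.vecMulVec (SkewElliptical.scale Om *ᵥ δ) (SkewElliptical.scale Om *ᵥ δ) ∧
      ∀ (T : Type*) [MeasurableSpace T] (Q : Measure T) [IsProbabilityMeasure Q]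
        (U₀ : T → ℝ) (U : T → Fin n → ℝ),
        HasLaw (fun w => Sum.elim (fun _ : Unit => U₀ w) (U w))
          (SkewElliptical.ecLaw (0 : Unit ⊕ Fin n → ℝ) (Matrix.fromBlocks 1 0 0 Psi) g) Q →
        (∀ᵐ u₀ ∂(Q.map U₀),
          SkewElliptical.IsDensityGenerator n (fun u => g (u + u₀ ^ 2)) ∧
          condDistrib U U₀ Q u₀ =
            SkewElliptical.ecLaw (0 : Fin n → ℝ) Psi (fun u => g (u + u₀ ^ 2))) ∧
        (∃ φ : ℝ → ℝ → ℝ, SkewElliptical.IsCondCharGenerator Q U₀ U Psi φ) ∧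
        ∀ φ : ℝ → ℝ → ℝ, SkewElliptical.IsCondCharGenerator Q U₀ U Psi φ →
          ∀ t : Fin n → ℝ,
            IntegrableOn (fun u₀ : ℝ =>
              Complex.exp (Complex.I * (((t ⬝ᵥ (SkewElliptical.scale Om *ᵥ δ)) * u₀ : ℝ) : ℂ)) *
                ((φ u₀ (t ⬝ᵥ ((SkewElliptical.scale Om * SkewElliptical.deltaMat δ * Psi *
                  SkewElliptical.deltaMat δ * SkewElliptical.scale Om) *ᵥ t)) : ℝ) : ℂ))
              (Set.Ioi 0) (Q.map U₀) ∧
            ∫ s, Complex.exp (Complex.I * ((t ⬝ᵥ X s : ℝ) : ℂ)) ∂P =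
              2 * Complex.exp (Complex.I * ((t ⬝ᵥ μ : ℝ) : ℂ)) *
                ∫ u₀ in Set.Ioi (0 : ℝ),
                  Complex.exp
                      (Complex.I * (((t ⬝ᵥ (SkewElliptical.scale Om *ᵥ δ)) * u₀ : ℝ) : ℂ)) *
                    ((φ u₀ (t ⬝ᵥ ((SkewElliptical.scale Om * SkewElliptical.deltaMat δ * Psi *
                      SkewElliptical.deltaMat δ * SkewElliptical.scale Om) *ᵥ t)) : ℝ) : ℂ)
                  ∂(Q.map U₀) := by
  refine ⟨SkewElliptical.existsUnique_isAdditiveParam hOm α, fun δ Psi hp => ?_⟩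
  refine ⟨hp.scale_mul_eq hOm, ?_⟩
  intro T _ Q _ U₀ U hlaw
  have h := SkewElliptical.hasLaw_pairLaw hg hp.posDef hlaw
  refine ⟨?_, SkewElliptical.exists_isCondCharGenerator hg hp.posDef h, fun φ hφ t => ?_⟩
  · have hgen := SkewElliptical.ae_map_fst_pairLaw_isDensityGenerator hn hg hp.posDef
    rw [SkewElliptical.map_fst_pairLaw h] at hgen
    exact hgen.and (SkewElliptical.ae_condDistrib_eq_ecLaw hg hp.posDef h)
  · have hmain := hp.integrableOn_and_integral_exp hg hOm μ h hφ t
    refine ⟨hmain.1, ?_⟩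
    rw [← hmain.2]
    exact hX.integral_comp
      (SkewElliptical.continuous_exp_dotProduct t).aestronglyMeasurable
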